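/- Let $V$ be a finite-dimensional complex vector space, let $G\subset \mathrm{GL}(V)$ be a complex reflection group (a finite subgroup generated by reflections, i.e. by elements of finite order that fix some hyperplane pointwise), and let $N\trianglelefteq G$ be a normal subgroup that is also generated by reflections. For $K\in\{G,N\}$ let $\mathcal{C}_K\subset S(V^*)$ be the graded $K$-module of $K$-harmonic polynomials, that is, of the polynomials annihilated by all $K$-invariant polynomial differential operators (elements of $S(V)$ acting on $S(V^*)$ as constant-coefficient differential operators) with no constant term; $\mathcal{C}_N$ is $G$-stable. For a finite-dimensional complex representation $M$ of $K$ of dimension $m$, the $M$-exponents $e_1^K(M),\dots,e_m^K(M)$ of $K$ are the nonnegative integers, counted with multiplicity, determined by $$\sum_{n\ge 0}\dim_{\mathbb{C}}\mathrm{Hom}_K\bigl(M,(\mathcal{C}_K)_n\bigr)\,q^n=\sum_{i=1}^m q^{e_i^K(M)}.$$ Let $M$ be a finite-dimensional complex representation of $G$ of dimension $m$, and let $U_M^N$ be the $G$-module dual to $(\mathcal{C}_N\otimes M^*)^N$. Then each of the three families of exponents $e_i^N(M)$ (where $M$ is restricted to $N$), $e_i^G(U_M^N)$ and $e_i^G(M)$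 has exactly $m$ members, and they can be indexed by $i=1,\dots,m$ so that $$e_i^N(M)+e_i^G(U_M^N)=e_i^G(M)\qquad\text{for all } i=1,\dots,m.$$ -/

import Mathlib

open scoped TensorProduct

noncomputable section

namespace ReflGroup

/-! ### Symmetric algebras: functorial action, grading, directional derivatives -/

section Symmetric

variable {Γ : Type*} [Group Γ] {W : Type*} [AddCommGroup W] [Module ℂ W]

/-- The action of a group on the symmetric algebra `S(W)` by algebra automorphisms induced from a
linear action `ρ` on `W`. -/
def symRep (ρ : Representation ℂ Γ W) : Representation ℂ Γ (SymmetricAlgebra ℂ W) where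
  toFun g := (SymmetricAlgebra.lift (SymmetricAlgebra.ι ℂ W ∘ₗ ρ g)).toLinearMap
  map_one' := by
    have h : SymmetricAlgebra.lift (SymmetricAlgebra.ι ℂ W ∘ₗ ρ 1) =
        AlgHom.id ℂ (SymmetricAlgebra ℂ W) := by
      ext x; simp
    rw [h]; rfl
  map_mul' g h := by
    have e : SymmetricAlgebra.lift (SymmetricAlgebra.ι ℂ W ∘ₗ ρ (g * h)) =
        (SymmetricAlgebra.lift (SymmetricAlgebra.ι ℂ W ∘ₗ ρ g)).comp
          (SymmetricAlgebra.lift (SymmetricAlgebra.ι ℂ W ∘ₗ ρ h)) := by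
      ext x; simp
    rw [e]; rfl

theorem symRep_ι (ρ : Representation ℂ Γ W) (g : Γ) (w : W) :
    symRep ρ g (SymmetricAlgebra.ι ℂ W w) = SymmetricAlgebra.ι ℂ W (ρ g w) := by
  simp [symRep]

theorem symRep_mul (ρ : Representation ℂ Γ W) (g : Γ) (a b : SymmetricAlgebra ℂ W) :
    symRep ρ g (a * b) = symRep ρ g a * symRep ρ g b := by
  simp [symRep]

theorem symRep_algebraMap (ρ : Representation ℂ Γ W) (g : Γ) (c : ℂ) :
    symRep ρ g (algebraMap ℂ _ c) = algebraMap ℂ _ c := by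
  simp [symRep]

variable (W) in
/-- The homogeneous component `S^n(W)` of degree `n` of the symmetric algebra: the span of the
products of `n` elements of `W`. -/
def homog (n : ℕ) : Submodule ℂ (SymmetricAlgebra ℂ W) :=
  LinearMap.range (SymmetricAlgebra.ι ℂ W) ^ n

theorem homog_stable (ρ : Representation ℂ Γ W) (n : ℕ) (g : Γ) :
    homog W n ≤ (homog W n).comap (symRep ρ g) := by
  rw [← Submodule.map_le_iff_le_comap]
  unfold homog
  change Submodule.map
    (SymmetricAlgebra.lift (SymmetricAlgebra.ι ℂ W ∘ₗ ρ g)).toLinearMap _ ≤ _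
  rw [Submodule.map_pow]
  refine pow_le_pow_left' ?_ n
  rintro _ ⟨_, ⟨w, rfl⟩, rfl⟩
  exact ⟨ρ g w, by simp⟩

end Symmetric

variable {V : Type*} [AddCommGroup V] [Module ℂ V]

/-- The algebra homomorphism `f ↦ f + ε ∂_v f` from `S(V*)` to the dual numbers over it. -/
def jet (v : V) : SymmetricAlgebra ℂ (Module.Dual ℂ V) →ₐ[ℂ]
    TrivSqZeroExt (SymmetricAlgebra ℂ (Module.Dual ℂ V))
      (SymmetricAlgebra ℂ (Module.Dual ℂ V)) :=
  SymmetricAlgebra.lift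
    ((TrivSqZeroExt.inlAlgHom ℂ (SymmetricAlgebra ℂ (Module.Dual ℂ V))
        (SymmetricAlgebra ℂ (Module.Dual ℂ V))).toLinearMap ∘ₗ SymmetricAlgebra.ι ℂ _ +
      (TrivSqZeroExt.inrHom (SymmetricAlgebra ℂ (Module.Dual ℂ V))
        (SymmetricAlgebra ℂ (Module.Dual ℂ V))).restrictScalars ℂ ∘ₗ
          Algebra.linearMap ℂ _ ∘ₗ Module.Dual.eval ℂ V v)

theorem jet_fst (v : V) (f : SymmetricAlgebra ℂ (Module.Dual ℂ V)) : (jet v f).fst = f := by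
  have h : (TrivSqZeroExt.fstHom ℂ (SymmetricAlgebra ℂ (Module.Dual ℂ V))
      (SymmetricAlgebra ℂ (Module.Dual ℂ V))).comp (jet v) = AlgHom.id ℂ _ := by
    ext φ; simp [jet]
  exact congrArg (fun F => F f) h

/-- The directional derivative `∂_v` on `S(V*)`: the derivation with `∂_v φ = φ v` for linear
forms `φ`. -/
def dirDeriv (v : V) : Module.End ℂ (SymmetricAlgebra ℂ (Module.Dual ℂ V)) where
  toFun f := (jet v f).snd
  map_add' a b := by simp
  map_smul' c a := by simp

theorem dirDeriv_ι (v : V) (φ : Module.Dual ℂ V) :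
    dirDeriv v (SymmetricAlgebra.ι ℂ _ φ) = algebraMap ℂ _ (φ v) := by
  simp [dirDeriv, jet, Algebra.algebraMap_eq_smul_one]

theorem dirDeriv_algebraMap (v : V) (c : ℂ) :
    dirDeriv v (algebraMap ℂ (SymmetricAlgebra ℂ (Module.Dual ℂ V)) c) = 0 := by
  change (jet v (algebraMap ℂ _ c)).snd = 0
  rw [AlgHom.commutes]
  rfl

theorem dirDeriv_mul (v : V) (a b : SymmetricAlgebra ℂ (Module.Dual ℂ V)) :
    dirDeriv v (a * b) = a * dirDeriv v b + b * dirDeriv v a := by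
  simp [dirDeriv, jet_fst, mul_comm]

theorem dirDeriv_comm (v w : V) : dirDeriv v * dirDeriv w = dirDeriv w * dirDeriv v := by
  ext f
  simp only [Module.End.mul_apply]
  induction f using SymmetricAlgebra.induction with
  | algebraMap c => simp [dirDeriv_algebraMap]
  | ι φ => simp [dirDeriv_ι, dirDeriv_algebraMap]
  | add a b ha hb => simp only [map_add, ha, hb]
  | mul a b ha hb => simp only [dirDeriv_mul, map_add, ha, hb]; ring

variable (V) in
/-- The map `v ↦ ∂_v`. -/
def dirDerivₗ : V →ₗ[ℂ] Module.End ℂ (SymmetricAlgebra ℂ (Module.Dual ℂ V)) where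
  toFun := dirDeriv
  map_add' v w := by
    ext f
    induction f using SymmetricAlgebra.induction with
    | algebraMap c => simp [dirDeriv_algebraMap]
    | ι φ => simp [dirDeriv_ι]
    | add a b ha hb => simp only [map_add, ha, hb]
    | mul a b ha hb =>
      simp only [LinearMap.add_apply] at ha hb
      simp only [LinearMap.add_apply, dirDeriv_mul, ha, hb]; ring
  map_smul' c v := by
    ext f
    induction f using SymmetricAlgebra.induction with
    | algebraMap c => simp [dirDeriv_algebraMap]
    | ι φ => simp [dirDeriv_ι, Algebra.smul_def]
    | add a b ha hb => simp only [map_add, ha, hb]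
    | mul a b ha hb =>
      simp only [LinearMap.smul_apply, RingHom.id_apply] at ha hb
      simp only [LinearMap.smul_apply, RingHom.id_apply, dirDeriv_mul, ha, hb, smul_add,
        Algebra.mul_smul_comm]

variable (V) in
theorem dirDeriv_comm_range :
    ∀ a ∈ Set.range (dirDerivₗ V), ∀ b ∈ Set.range (dirDerivₗ V), a * b = b * a := by
  rintro _ ⟨v, rfl⟩ _ ⟨w, rfl⟩
  exact dirDeriv_comm v w

open scoped IsMulCommutative in
variable (V) in
/-- The polynomial (constant coefficient) differential operators: the algebra homomorphism
`p ↦ p(∂)` from `S(V)` to the endomorphisms of `S(V*)` that sends `v` to `∂_v`. It is obtained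
from the universal property of `S(V)`, applied to the commutative algebra generated by all `∂_v`. -/
def diffOp : SymmetricAlgebra ℂ V →ₐ[ℂ]
    Module.End ℂ (SymmetricAlgebra ℂ (Module.Dual ℂ V)) :=
  haveI := Algebra.isMulCommutative_adjoin ℂ (dirDeriv_comm_range V)
  (Algebra.adjoin ℂ (Set.range (dirDerivₗ V))).val.comp
    (SymmetricAlgebra.lift
      ((dirDerivₗ V).codRestrict (Subalgebra.toSubmodule (Algebra.adjoin ℂ (Set.range (dirDerivₗ V))))
        (fun v => Algebra.subset_adjoin ⟨v, rfl⟩)))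

open scoped IsMulCommutative in
theorem diffOp_ι (v : V) : diffOp V (SymmetricAlgebra.ι ℂ V v) = dirDeriv v := by
  have := Algebra.isMulCommutative_adjoin ℂ (dirDeriv_comm_range V)
  simp only [diffOp, AlgHom.comp_apply]
  erw [SymmetricAlgebra.lift_ι_apply]
  rfl

/-! ### Reflection groups and harmonic polynomials -/

variable (V) in
/-- The tautological representation of `GL(V)` on `V`. -/
def stdRep : Representation ℂ (LinearMap.GeneralLinearGroup ℂ V) V :=
  Units.coeHom (Module.End ℂ V)

/-- A reflection: an element of finite order of `GL(V)` that fixes some hyperplane pointwise.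
(The identity is allowed when `V ≠ 0`; this has no effect on generated subgroups.) -/
def IsReflection (g : LinearMap.GeneralLinearGroup ℂ V) : Prop :=
  IsOfFinOrder g ∧ ∃ P : Submodule ℂ V, Module.finrank ℂ P + 1 = Module.finrank ℂ V ∧
    ∀ x ∈ P, stdRep V g x = x

/-- A complex reflection group: a finite subgroup of `GL(V)` generated by reflections. -/
structure IsReflectionGroup (K : Subgroup (LinearMap.GeneralLinearGroup ℂ V)) : Prop where
  finite : Finite K
  generated : Subgroup.closure {g | g ∈ K ∧ IsReflection g} = K

variable (V) in
/-- The action of `GL(V)` on the polynomial functions `S(V*)`. -/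
def polyRep : Representation ℂ (LinearMap.GeneralLinearGroup ℂ V)
    (SymmetricAlgebra ℂ (Module.Dual ℂ V)) :=
  symRep (stdRep V).dual

variable (V) in
/-- The action of `GL(V)` on `S(V)`, the symbols of polynomial differential operators. -/
def symbolRep : Representation ℂ (LinearMap.GeneralLinearGroup ℂ V) (SymmetricAlgebra ℂ V) :=
  symRep (stdRep V)

theorem dirDeriv_equivariant (g : LinearMap.GeneralLinearGroup ℂ V) (v : V)
    (f : SymmetricAlgebra ℂ (Module.Dual ℂ V)) :
    dirDeriv (stdRep V g v) (polyRep V g f) = polyRep V g (dirDeriv v f) := by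
  unfold polyRep
  induction f using SymmetricAlgebra.induction with
  | algebraMap c => simp [symRep_algebraMap, dirDeriv_algebraMap]
  | ι φ =>
    rw [symRep_ι, dirDeriv_ι, dirDeriv_ι, symRep_algebraMap, Representation.dual_apply]
    congr 1
    change φ (stdRep V g⁻¹ (stdRep V g v)) = φ v
    rw [← Module.End.mul_apply, ← map_mul]
    simp
  | add a b ha hb => simp only [map_add, ha, hb]
  | mul a b ha hb => simp only [symRep_mul, dirDeriv_mul, map_add, ha, hb]

theorem diffOp_equivariant (g : LinearMap.GeneralLinearGroup ℂ V) (p : SymmetricAlgebra ℂ V) :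
    ∀ f : SymmetricAlgebra ℂ (Module.Dual ℂ V),
      diffOp V (symbolRep V g p) (polyRep V g f) = polyRep V g (diffOp V p f) := by
  unfold symbolRep
  induction p using SymmetricAlgebra.induction with
  | algebraMap c => intro f; simp [symRep_algebraMap, Module.algebraMap_end_apply]
  | ι v => intro f; rw [symRep_ι, diffOp_ι, diffOp_ι, dirDeriv_equivariant]
  | add a b ha hb => intro f; simp only [map_add, LinearMap.add_apply, ha, hb]
  | mul a b ha hb =>
    intro f
    simp only [symRep_mul, map_mul, Module.End.mul_apply, ha, hb]

/-- The space `C_K` of `K`-harmonic polynomials: the polynomials annihilated by all `K`-invariant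
polynomial differential operators with no constant term. -/
def harmonic (K : Subgroup (LinearMap.GeneralLinearGroup ℂ V)) :
    Submodule ℂ (SymmetricAlgebra ℂ (Module.Dual ℂ V)) where
  carrier := {f | ∀ p : SymmetricAlgebra ℂ V, (∀ k ∈ K, symbolRep V k p = p) →
    SymmetricAlgebra.algebraMapInv p = 0 → diffOp V p f = 0}
  zero_mem' := by intro p _ _; simp
  add_mem' := by
    intro a b ha hb p h1 h2
    rw [map_add, ha p h1 h2, hb p h1 h2, add_zero]
  smul_mem' := by
    intro c a ha p h1 h2
    rw [map_smul, ha p h1 h2, smul_zero]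

theorem algebraMapInv_symRep {Γ W : Type*} [Group Γ] [AddCommGroup W] [Module ℂ W]
    (ρ : Representation ℂ Γ W) (g : Γ) (p : SymmetricAlgebra ℂ W) :
    SymmetricAlgebra.algebraMapInv (symRep ρ g p) = SymmetricAlgebra.algebraMapInv p := by
  have h : (SymmetricAlgebra.algebraMapInv (R := ℂ) (M := W)).comp
      (SymmetricAlgebra.lift (SymmetricAlgebra.ι ℂ W ∘ₗ ρ g)) =
        SymmetricAlgebra.algebraMapInv := by
    ext x; simp [SymmetricAlgebra.algebraMapInv_ι]
  exact congrArg (fun F => F p) h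

/-- The harmonic polynomials of `K` are stable under the normalizer of `K`. -/
theorem harmonic_stable (K : Subgroup (LinearMap.GeneralLinearGroup ℂ V))
    (g : LinearMap.GeneralLinearGroup ℂ V) (hg : g ∈ Subgroup.normalizer (K : Set _)) :
    harmonic K ≤ (harmonic K).comap (polyRep V g) := by
  intro f hf p hp h0
  have e : symbolRep V g (symbolRep V g⁻¹ p) = p := by
    rw [← Module.End.mul_apply, ← map_mul]; simp
  rw [← e, diffOp_equivariant]
  rw [hf (symbolRep V g⁻¹ p) ?_ ?_, map_zero]
  · intro k hk
    have hk' : g * k * g⁻¹ ∈ K := (Subgroup.mem_normalizer_iff.1 hg k).1 hk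
    have h1 : symbolRep V k (symbolRep V g⁻¹ p) =
        symbolRep V g⁻¹ (symbolRep V (g * k * g⁻¹) p) := by
      simp only [← Module.End.mul_apply, ← map_mul]
      congr 2
      group
    rw [h1, hp _ hk']
  · unfold symbolRep; rw [algebraMapInv_symRep, h0]

/-- For a subgroup `G` that normalizes `K`, the `G`-module `C_K` of `K`-harmonic polynomials. -/
def harmonicRep (G K : Subgroup (LinearMap.GeneralLinearGroup ℂ V))
    (h : G ≤ Subgroup.normalizer (K : Set _)) : Representation ℂ G (harmonic K) :=
  Representation.subrepresentation ((polyRep V).comp G.subtype) (harmonic K)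
    (fun g => harmonic_stable K g (h g.2))

/-- The homogeneous component of degree `n` of the space of `K`-harmonic polynomials. -/
def harmonicDeg (K : Subgroup (LinearMap.GeneralLinearGroup ℂ V)) (n : ℕ) :
    Submodule ℂ (SymmetricAlgebra ℂ (Module.Dual ℂ V)) :=
  harmonic K ⊓ homog (Module.Dual ℂ V) n

/-- The `K`-module of `K`-harmonic polynomials of degree `n`. -/
def harmonicDegRep (K : Subgroup (LinearMap.GeneralLinearGroup ℂ V)) (n : ℕ) :
    Representation ℂ K (harmonicDeg K n) :=
  Representation.subrepresentation ((polyRep V).comp K.subtype) (harmonicDeg K n) (fun k _ hf =>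
    ⟨harmonic_stable K k (Subgroup.le_normalizer k.2) hf.1,
      homog_stable (stdRep V).dual n k.1 hf.2⟩)

section TensorInvariants

variable {Γ A B : Type*} [Group Γ] [AddCommGroup A] [Module ℂ A] [AddCommGroup B] [Module ℂ B]

/-- The invariants `(A ⊗ B)^S` of a subgroup `S` of `Γ` on a tensor product of `Γ`-modules. -/
def tensorInvariants (α : Representation ℂ Γ A) (β : Representation ℂ Γ B) (S : Subgroup Γ) :
    Submodule ℂ (A ⊗[ℂ] B) :=
  Representation.invariants (V := A ⊗[ℂ] B) ((α.tprod β).comp S.subtype)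

/-- The `Γ`-module `(A ⊗ B)^S` for a normal subgroup `S` of `Γ`. -/
def tensorInvariantsRep (α : Representation ℂ Γ A) (β : Representation ℂ Γ B) (S : Subgroup Γ)
    [S.Normal] : Representation ℂ Γ (tensorInvariants α β S) :=
  Representation.toInvariants (V := A ⊗[ℂ] B) (α.tprod β) S

end TensorInvariants

/-! ### Fake degrees, exponents and Orlik-Solomon spaces -/

section Exponents

variable {M : Type*} [AddCommGroup M] [Module ℂ M]

/-- The fake degree `f_M(q) = ∑ₙ ((C_K)ₙ, M) qⁿ` of the `K`-module `M`, where the multiplicity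
`((C_K)ₙ, M)` is the dimension of `Hom_K(M, (C_K)ₙ)`; it is additive in `M`. -/
def fakeDegree (K : Subgroup (LinearMap.GeneralLinearGroup ℂ V)) (ρ : Representation ℂ K M) :
    PowerSeries ℕ :=
  PowerSeries.mk fun n =>
    Module.finrank ℂ (Representation.IntertwiningMap ρ (harmonicDegRep K n))

/-- The family `e` is an indexing of the `M`-exponents of `K`, that is,
`f_M(q) = ∑ᵢ q ^ (e i)`. -/
def IsExponents (K : Subgroup (LinearMap.GeneralLinearGroup ℂ V)) (ρ : Representation ℂ K M)
    {ι : Type*} [Fintype ι] (e : ι → ℕ) : Prop :=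
  fakeDegree K ρ = ∑ i, (PowerSeries.X : PowerSeries ℕ) ^ e i

variable {G N : Subgroup (LinearMap.GeneralLinearGroup ℂ V)}

/-- The dual Orlik-Solomon space `(C_N ⊗ M*)^N`, for `N` a normal subgroup of `G` and `M` a
`G`-module. -/
abbrev OSDual (hNG : N ≤ G) [hn : (N.subgroupOf G).Normal] (ρ : Representation ℂ G M) :
    Submodule ℂ (harmonic N ⊗[ℂ] Module.Dual ℂ M) :=
  tensorInvariants (harmonicRep G N ((Subgroup.normal_subgroupOf_iff_le_normalizer hNG).1 hn))
    ρ.dual (N.subgroupOf G)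

/-- The `G`-module structure of `(C_N ⊗ M*)^N`. -/
def OSDualRep (hNG : N ≤ G) [hn : (N.subgroupOf G).Normal] (ρ : Representation ℂ G M) :
    Representation ℂ G (OSDual hNG ρ) :=
  tensorInvariantsRep (harmonicRep G N ((Subgroup.normal_subgroupOf_iff_le_normalizer hNG).1 hn))
    ρ.dual (N.subgroupOf G)

/-- The Orlik-Solomon space of `N` and `M`, the `G`-module dual to `(C_N ⊗ M*)^N`. -/
def OSRep (hNG : N ≤ G) [(N.subgroupOf G).Normal] (ρ : Representation ℂ G M) :
    Representation ℂ G (Module.Dual ℂ (OSDual hNG ρ)) :=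
  (OSDualRep hNG ρ).dual

/-- The restriction of a `G`-module to a subgroup `N` of `G`. -/
def restrictRep (hNG : N ≤ G) (ρ : Representation ℂ G M) : Representation ℂ N M :=
  ρ.comp (Subgroup.inclusion hNG)

end Exponents

end ReflGroup

end

noncomputable section

namespace ReflGroup

/-! ### The grading of the symmetric algebra -/

section Grading

open scoped DirectSum

variable {W : Type*} [AddCommGroup W] [Module ℂ W]

/-! Write `S` for the polynomials, `S^K` for the invariants and `C_K` for the harmonics. Let
`x(d,l)` be the multiplicity in `(C_G)_l` of the dual of `((C_N)_d ⊗ M*)^N` (`bimult`). All three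
fake degrees can be read off this one array: summing over `l` gives that of `M` for `N`
(`mult_restrictRep`), summing over `d` that of the Orlik-Solomon space (`mult_OSRep`), and summing
over `d + l = n` that of `M` for `G` (`mult_eq_sum`). Take one index for each unit of `x(d,l)`: the
exponents attached to it are `d`, `l` and `d + l`, so they add up.

The sum over `l` rests on `C_G` being the regular representation: the total multiplicity of a module
in it is its dimension (`sum_mult`), and `((C_N)_d ⊗ M*)^N` has the dimension of `Hom_N(M,
(C_N)_d)`. The sum over `d` is additivity of multiplicities. For the diagonal sum, `S = S^N ⊗ C_N`
gives, in characters, `(S ⊗ M*)^G = (S^N ⊗ C_N ⊗ M*)^G = (S ⊗ (C_N ⊗ M*)^N)^G`. Decomposing the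
outer terms by `S = S^G ⊗ C_G` puts the Hilbert series of `S^G` on both sides, and it cancels.

The invariant theory behind this has three sources. For a Hermitian form in which multiplication is
adjoint to differentiation, `C_K` is the orthogonal complement of the ideal of coinvariants
(`mem_harmonic_iff`), whence `S = S^K C_K`. Chevalley's argument with reflections
(`chevalley_relation`) makes this product decomposition free. Dedekind's independence of
automorphisms, applied to the matrix of translates of a basis of `C_K`, identifies the character of
`C_K` (`trace_harmonic`). -/

instance homog_gradedMonoid : SetLike.GradedMonoid (homog W) :=
  inferInstanceAs (SetLike.GradedMonoid
    ((LinearMap.range (SymmetricAlgebra.ι ℂ W) ^ ·) : ℕ → Submodule ℂ _))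

theorem ι_mem_homog (w : W) : SymmetricAlgebra.ι ℂ W w ∈ homog W 1 := by
  simpa only [homog, pow_one] using LinearMap.mem_range_self _ w

variable (W) in
/-- The map `ι` into the direct sum of the homogeneous components. -/
def gradedι : W →ₗ[ℂ] ⨁ i : ℕ, homog W i :=
  DirectSum.lof ℂ ℕ (fun i => homog W i) 1 ∘ₗ
    (SymmetricAlgebra.ι ℂ W).codRestrict _ fun m => ι_mem_homog m

theorem gradedι_apply (w : W) : gradedι W w =
    DirectSum.of (fun i : ℕ => homog W i) 1 ⟨SymmetricAlgebra.ι ℂ W w, ι_mem_homog w⟩ :=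
  rfl

/-- The symmetric algebra is graded by the powers of the generating space. -/
instance homog_gradedAlgebra : GradedAlgebra (homog W) :=
  GradedAlgebra.ofAlgHom _ (SymmetricAlgebra.lift <| gradedι W)
    (by
      ext m
      change DirectSum.coeAlgHom (homog W) (SymmetricAlgebra.lift (gradedι W)
        (SymmetricAlgebra.ι ℂ W m)) = SymmetricAlgebra.ι ℂ W m
      rw [SymmetricAlgebra.lift_ι_apply, gradedι_apply, DirectSum.coeAlgHom_of, Subtype.coe_mk])
    fun i x => by
    obtain ⟨x, hx⟩ := x
    dsimp only [Subtype.coe_mk, DirectSum.lof_eq_of]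
    induction hx using Submodule.pow_induction_on_left' with
    | algebraMap r =>
      rw [AlgHom.commutes, DirectSum.algebraMap_apply]; rfl
    | add x y i hx hy ihx ihy =>
      rw [map_add, ihx, ihy, ← map_add]
      rfl
    | mem_mul m hm i x hx ih =>
      obtain ⟨_, rfl⟩ := hm
      rw [map_mul, ih, SymmetricAlgebra.lift_ι_apply, gradedι_apply, DirectSum.of_mul_of]
      exact DirectSum.of_eq_of_gradedMonoid_eq (Sigma.subtype_ext (add_comm _ _) rfl)

variable (W) in
/-- The projection of the symmetric algebra to its homogeneous component of degree `n`. -/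
def hcomp (n : ℕ) : SymmetricAlgebra ℂ W →ₗ[ℂ] SymmetricAlgebra ℂ W :=
  (homog W n).subtype ∘ₗ DirectSum.component ℂ ℕ (fun i => homog W i) n ∘ₗ
    (DirectSum.decomposeLinearEquiv (homog W)).toLinearMap

theorem hcomp_eq (n : ℕ) (x : SymmetricAlgebra ℂ W) :
    hcomp W n x = (DirectSum.decompose (homog W) x n : SymmetricAlgebra ℂ W) := rfl

theorem hcomp_mem (n : ℕ) (x : SymmetricAlgebra ℂ W) : hcomp W n x ∈ homog W n := by
  rw [hcomp_eq]; exact SetLike.coe_mem _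

theorem hcomp_of_mem {n : ℕ} {x : SymmetricAlgebra ℂ W} (h : x ∈ homog W n) :
    hcomp W n x = x := DirectSum.decompose_of_mem_same _ h

theorem hcomp_of_mem_ne {m n : ℕ} {x : SymmetricAlgebra ℂ W} (h : x ∈ homog W m) (hmn : m ≠ n) :
    hcomp W n x = 0 := DirectSum.decompose_of_mem_ne _ h hmn

theorem hcomp_mul_of_le {d n : ℕ} (x : SymmetricAlgebra ℂ W) {b : SymmetricAlgebra ℂ W}
    (hb : b ∈ homog W d) (h : d ≤ n) : hcomp W n (x * b) = hcomp W (n - d) x * b :=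
  DirectSum.coe_decompose_mul_of_right_mem_of_le (homog W) hb h

theorem hcomp_mul_of_not_le {d n : ℕ} (x : SymmetricAlgebra ℂ W) {b : SymmetricAlgebra ℂ W}
    (hb : b ∈ homog W d) (h : ¬ d ≤ n) : hcomp W n (x * b) = 0 :=
  DirectSum.coe_decompose_mul_of_right_mem_of_not_le (homog W) hb h

theorem exists_sum_hcomp (x : SymmetricAlgebra ℂ W) :
    ∃ s : Finset ℕ, x = ∑ n ∈ s, hcomp W n x := by
  classical
  exact ⟨_, (DirectSum.sum_support_decompose (homog W) x).symm⟩

/-- Both sides are additive in `y`, so `y` may be taken homogeneous; then at most one summand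
survives. -/
theorem hcomp_mul (n : ℕ) (x y : SymmetricAlgebra ℂ W) :
    hcomp W n (x * y) = ∑ m : Fin (n + 1), hcomp W (n - m) x * hcomp W m y := by
  obtain ⟨s, hs⟩ := exists_sum_hcomp y
  have key : ∀ d, hcomp W n (x * hcomp W d y) =
      ∑ m : Fin (n + 1), hcomp W (n - m) x * hcomp W m (hcomp W d y) := by
    intro d
    by_cases h : d ≤ n
    · rw [hcomp_mul_of_le _ (hcomp_mem d y) h,
        Finset.sum_eq_single ⟨d, Nat.lt_succ_iff.2 h⟩, hcomp_of_mem (hcomp_mem d y)]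
      · intro m _ hm
        rw [hcomp_of_mem_ne (hcomp_mem d y) (fun hd => hm (Fin.ext hd.symm)), mul_zero]
      · simp
    · rw [hcomp_mul_of_not_le _ (hcomp_mem d y) h, Finset.sum_eq_zero]
      intro m _
      rw [hcomp_of_mem_ne (hcomp_mem d y) (by have := m.2; omega), mul_zero]
  conv_lhs => rw [hs, Finset.mul_sum, map_sum]
  conv_rhs => rw [hs]
  simp only [map_sum, Finset.mul_sum, key]
  rw [Finset.sum_comm]

theorem eq_zero_of_hcomp_eq_zero {x : SymmetricAlgebra ℂ W} (h : ∀ n, hcomp W n x = 0) :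
    x = 0 := by
  obtain ⟨s, hs⟩ := exists_sum_hcomp x
  rw [hs]; exact Finset.sum_eq_zero fun n _ => h n

theorem mem_of_hcomp_mem {p : Submodule ℂ (SymmetricAlgebra ℂ W)} {x : SymmetricAlgebra ℂ W}
    (h : ∀ n, hcomp W n x ∈ p) : x ∈ p := by
  obtain ⟨s, hs⟩ := exists_sum_hcomp x
  rw [hs]; exact Submodule.sum_mem _ fun n _ => h n

instance homog_finite [FiniteDimensional ℂ W] (n : ℕ) : FiniteDimensional ℂ (homog W n) :=
  Module.Finite.iff_fg.2 (Submodule.FG.pow (Module.Finite.iff_fg.1 inferInstance) n)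

theorem homog_zero_eq {x : SymmetricAlgebra ℂ W} (h : x ∈ homog W 0) :
    ∃ c : ℂ, algebraMap ℂ _ c = x := by
  simpa only [homog, pow_zero, Submodule.mem_one] using h

theorem algebraMap_mem_homog (c : ℂ) :
    algebraMap ℂ (SymmetricAlgebra ℂ W) c ∈ homog W 0 := by
  simp only [homog, pow_zero, Submodule.mem_one, exists_apply_eq_apply]

theorem algebraMapInv_algebraMap (c : ℂ) :
    SymmetricAlgebra.algebraMapInv (algebraMap ℂ (SymmetricAlgebra ℂ W) c) = c := by
  simp

theorem algebraMapInv_of_mem_homog_succ {n : ℕ} {x : SymmetricAlgebra ℂ W}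
    (h : x ∈ homog W (n + 1)) : SymmetricAlgebra.algebraMapInv x = 0 := by
  rw [homog, pow_succ'] at h
  induction h using Submodule.mul_induction_on' with
  | mem_mul_mem m hm y hy =>
    obtain ⟨w, rfl⟩ := hm
    rw [map_mul, SymmetricAlgebra.algebraMapInv_ι, zero_mul]
  | add x _ y _ hx hy => rw [map_add, hx, hy, add_zero]

/-- The homogeneous component of degree `0` is the constant term. -/
theorem hcomp_zero (x : SymmetricAlgebra ℂ W) :
    hcomp W 0 x = algebraMap ℂ _ (SymmetricAlgebra.algebraMapInv x) := by
  classical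
  conv_rhs => rw [← DirectSum.sum_support_decompose (homog W) x]
  obtain ⟨c, hc⟩ := homog_zero_eq (hcomp_mem 0 x)
  rw [map_sum, map_sum, Finset.sum_eq_single 0]
  · rw [← hcomp_eq, ← hc, algebraMapInv_algebraMap]
  · intro n _ hn
    obtain ⟨m, rfl⟩ := Nat.exists_eq_succ_of_ne_zero hn
    rw [algebraMapInv_of_mem_homog_succ (SetLike.coe_mem _), map_zero]
  · intro h
    rw [DFinsupp.notMem_support_iff.1 h]; simp

variable {Γ : Type*} [Group Γ]

theorem symRep_mem_homog (ρ : Representation ℂ Γ W) {n : ℕ} (g : Γ) {x : SymmetricAlgebra ℂ W}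
    (h : x ∈ homog W n) : symRep ρ g x ∈ homog W n := homog_stable ρ n g h

theorem hcomp_symRep (ρ : Representation ℂ Γ W) (n : ℕ) (g : Γ) (x : SymmetricAlgebra ℂ W) :
    hcomp W n (symRep ρ g x) = symRep ρ g (hcomp W n x) := by
  obtain ⟨s, hs⟩ := exists_sum_hcomp x
  conv_lhs => rw [hs]
  conv_rhs => rw [hs]
  simp only [map_sum]
  refine Finset.sum_congr rfl fun m _ => ?_
  by_cases hmn : m = n
  · subst hmn
    rw [hcomp_of_mem (hcomp_mem m x), hcomp_of_mem (symRep_mem_homog ρ g (hcomp_mem m x))]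
  · rw [hcomp_of_mem_ne (hcomp_mem m x) hmn,
      hcomp_of_mem_ne (symRep_mem_homog ρ g (hcomp_mem m x)) hmn, map_zero]

theorem symRep_one (ρ : Representation ℂ Γ W) (g : Γ) : symRep ρ g 1 = 1 := by
  simpa using symRep_algebraMap ρ g 1

theorem symRep_mul_apply (ρ : Representation ℂ Γ W) (g h : Γ) (x : SymmetricAlgebra ℂ W) :
    symRep ρ (g * h) x = symRep ρ g (symRep ρ h x) := by
  rw [map_mul]; rfl

end Grading

/-! ### The Fischer form on polynomials -/

section Fischer

open MvPolynomial

variable {σ : Type*}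

/-- The multi-index factorial. -/
def multiFactorial (a : σ →₀ ℕ) : ℕ := a.prod fun _ k => k.factorial

theorem multiFactorial_pos (a : σ →₀ ℕ) : 0 < multiFactorial a :=
  Finset.prod_pos fun _ _ => Nat.factorial_pos _

theorem multiFactorial_sub_single (a : σ →₀ ℕ) {i : σ} (h : a i ≠ 0) :
    multiFactorial (a - Finsupp.single i 1) * a i = multiFactorial a := by
  classical
  have hle : (a - Finsupp.single i 1).support ⊆ a.support := Finsupp.support_mono tsub_le_self
  have hi : i ∈ a.support := Finsupp.mem_support_iff.2 h
  unfold multiFactorial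
  rw [Finsupp.prod_of_support_subset _ hle _ (fun _ _ => rfl), Finsupp.prod,
    ← Finset.mul_prod_erase _ _ hi, ← Finset.mul_prod_erase _ _ hi, mul_right_comm]
  congr 1
  · obtain ⟨k, hk⟩ := Nat.exists_eq_succ_of_ne_zero h
    simp [hk, Nat.factorial_succ, mul_comm]
  · refine Finset.prod_congr rfl fun j hj => ?_
    have : i ≠ j := (Finset.ne_of_mem_erase hj).symm
    simp [this]

/-- The Fischer form `⟨p, q⟩ = ∑ₐ a! p̄ₐ qₐ` on polynomials. -/
def fischer (p : MvPolynomial σ ℂ) : MvPolynomial σ ℂ →ₗ[ℂ] ℂ :=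
  (basisMonomials σ ℂ).constr ℂ fun a => (multiFactorial a : ℂ) * star (coeff a p)

theorem fischer_monomial (p : MvPolynomial σ ℂ) (a : σ →₀ ℕ) (c : ℂ) :
    fischer p (monomial a c) = c * (multiFactorial a * star (coeff a p)) := by
  have : monomial a c = c • basisMonomials σ ℂ a := by
    rw [coe_basisMonomials, smul_monomial, smul_eq_mul, mul_one]
  rw [this, map_smul, fischer, Module.Basis.constr_basis, smul_eq_mul]

theorem fischer_eq_sum (p q : MvPolynomial σ ℂ) {s : Finset (σ →₀ ℕ)} (hs : q.support ⊆ s) :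
    fischer p q = ∑ a ∈ s, coeff a q * (multiFactorial a * star (coeff a p)) := by
  conv_lhs => rw [← support_sum_monomial_coeff q, map_sum]
  simp only [fischer_monomial]
  refine Finset.sum_subset hs fun a _ ha => ?_
  rw [notMem_support_iff.1 ha, zero_mul]

theorem fischer_add_left (p p' q : MvPolynomial σ ℂ) :
    fischer (p + p') q = fischer p q + fischer p' q := by
  simp only [fischer_eq_sum _ q subset_rfl, coeff_add, star_add, mul_add, Finset.sum_add_distrib]

theorem fischer_smul_left (c : ℂ) (p q : MvPolynomial σ ℂ) :
    fischer (c • p) q = star c * fischer p q := by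
  simp only [fischer_eq_sum _ q subset_rfl, coeff_smul, smul_eq_mul, star_mul', Finset.mul_sum]
  exact Finset.sum_congr rfl fun _ _ => by ring

theorem star_fischer (p q : MvPolynomial σ ℂ) : star (fischer q p) = fischer p q := by
  classical
  rw [fischer_eq_sum q p (Finset.subset_union_left (s₂ := q.support)),
    fischer_eq_sum p q (Finset.subset_union_right (s₁ := p.support)), star_sum]
  refine Finset.sum_congr rfl fun a _ => ?_
  simp only [star_mul', star_star, star_natCast]
  ring

theorem fischer_self (p : MvPolynomial σ ℂ) :
    fischer p p = ((∑ a ∈ p.support, multiFactorial a * ‖coeff a p‖ ^ 2 : ℝ) : ℂ) := by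
  rw [fischer_eq_sum p p subset_rfl, Complex.ofReal_sum]
  refine Finset.sum_congr rfl fun a _ => ?_
  have := Complex.mul_conj' (coeff a p)
  push_cast
  rw [← this, starRingEnd_apply]; ring

theorem eq_zero_of_fischer_self {p : MvPolynomial σ ℂ} (h : fischer p p = 0) : p = 0 := by
  rw [fischer_self, Complex.ofReal_eq_zero, Finset.sum_eq_zero_iff_of_nonneg] at h
  · ext a
    by_contra ha
    have := h a (mem_support_iff.2 ha)
    have hpos : (0 : ℝ) < multiFactorial a := by exact_mod_cast multiFactorial_pos a
    rw [mul_eq_zero, or_iff_right hpos.ne', pow_eq_zero_iff two_ne_zero, norm_eq_zero] at this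
    exact ha this
  · intro a _; positivity

/-- Multiplication by a variable is adjoint to the partial derivative. -/
theorem fischer_X_mul (i : σ) (p q : MvPolynomial σ ℂ) :
    fischer (X i * p) q = fischer p (pderiv i q) := by
  classical
  induction q using MvPolynomial.induction_on' with
  | add q q' h h' => simp only [map_add, h, h']
  | monomial a c =>
    rw [pderiv_monomial, fischer_monomial, fischer_monomial, coeff_X_mul']
    by_cases h : a i = 0
    · simp [h]
    · rw [if_pos (Finsupp.mem_support_iff.2 h), ← multiFactorial_sub_single a h]
      push_cast; ring

/-- The inner product space structure given by the Fischer form. -/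
@[reducible] def fischerCore : InnerProductSpace.Core ℂ (MvPolynomial σ ℂ) where
  inner p q := fischer p q
  conj_inner_symm p q := star_fischer p q
  re_inner_nonneg p := by
    rw [fischer_self, RCLike.re_eq_complex_re, Complex.ofReal_re]
    exact Finset.sum_nonneg fun _ _ => by positivity
  add_left p q r := fischer_add_left p q r
  smul_left p q c := fischer_smul_left c p q
  definite _ h := eq_zero_of_fischer_self h

/-- The polynomial ring is not complete for the Fischer norm, but orthogonal projection onto a
finite-dimensional subspace always exists. -/
theorem exists_fischer_orthogonal (I : Submodule ℂ (MvPolynomial σ ℂ)) [FiniteDimensional ℂ I]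
    (f : MvPolynomial σ ℂ) : ∃ a ∈ I, ∀ x ∈ I, fischer x (f - a) = 0 := by
  let _ : NormedAddCommGroup (MvPolynomial σ ℂ) :=
    @InnerProductSpace.Core.toNormedAddCommGroup ℂ _ _ _ _ fischerCore
  let _ : InnerProductSpace ℂ (MvPolynomial σ ℂ) := InnerProductSpace.ofCore fischerCore.toCore
  obtain ⟨a, ha, z, hz, h⟩ := I.exists_add_mem_mem_orthogonal f
  refine ⟨a, ha, fun x hx => ?_⟩
  rw [h, add_sub_cancel_left]
  exact (Submodule.mem_orthogonal I z).1 hz x hx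

end Fischer

/-! ### Unitary bases -/

section Unitary

variable {V : Type*} [AddCommGroup V] [Module ℂ V]

/-- The matrices of the elements of `G` with respect to the basis `b` are unitary. -/
def IsUnitaryBasis {σ : Type*} (G : Subgroup (LinearMap.GeneralLinearGroup ℂ V))
    (b : Module.Basis σ ℂ V) : Prop :=
  ∀ g ∈ G, ∀ i j, b.repr (stdRep V g⁻¹ (b i)) j = star (b.repr (stdRep V g (b j)) i)

/-- The inner product that makes a basis orthonormal. -/
def basisForm {σ : Type*} [Fintype σ] (c : Module.Basis σ ℂ V) (u v : V) : ℂ :=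
  ∑ i, star (c.repr u i) * c.repr v i

/-- Averaging a Hermitian inner product over the finite group makes it invariant; an orthonormal
basis of the average does the job. -/
theorem exists_isUnitaryBasis [FiniteDimensional ℂ V]
    (G : Subgroup (LinearMap.GeneralLinearGroup ℂ V)) [Finite G] :
    ∃ b : Module.Basis (Fin (Module.finrank ℂ V)) ℂ V, IsUnitaryBasis G b := by
  have := Fintype.ofFinite G
  let c := Module.finBasis ℂ V
  let core : InnerProductSpace.Core ℂ V :=
    { inner u v := ∑ g : G, basisForm c (stdRep V g u) (stdRep V g v)
      conj_inner_symm u v := by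
        simp only [basisForm, map_sum, map_mul, starRingEnd_apply, star_star, mul_comm]
      re_inner_nonneg u := by
        simp only [basisForm, map_sum]
        refine Finset.sum_nonneg fun g _ => Finset.sum_nonneg fun i _ => ?_
        rw [← starRingEnd_apply, RCLike.conj_mul, ← RCLike.ofReal_pow, RCLike.ofReal_re]
        positivity
      add_left u v w := by
        simp only [basisForm, map_add, Finsupp.add_apply, star_add, add_mul,
          Finset.sum_add_distrib]
      smul_left u v r := by
        simp only [basisForm, map_smul, Finsupp.smul_apply, smul_eq_mul, star_mul',
          Finset.mul_sum, mul_assoc, starRingEnd_apply]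
      definite u h := by
        have h' : (∑ g : G, ∑ i, ‖c.repr (stdRep V g u) i‖ ^ 2 : ℝ) = 0 := by
          rw [← Complex.ofReal_eq_zero]
          push_cast
          rw [← h]
          simp only [basisForm]
          refine Finset.sum_congr rfl fun g _ => Finset.sum_congr rfl fun i _ => ?_
          rw [← starRingEnd_apply, Complex.conj_mul']
        rw [Finset.sum_eq_zero_iff_of_nonneg
          (fun g _ => Finset.sum_nonneg fun i _ => by positivity)] at h'
        have h1 := h' 1 (Finset.mem_univ _)
        rw [Finset.sum_eq_zero_iff_of_nonneg (fun i _ => by positivity)] at h1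
        refine c.repr.map_eq_zero_iff.1 (Finsupp.ext fun i => ?_)
        simpa using h1 i (Finset.mem_univ _) }
  have hinv : ∀ g ∈ G, ∀ u v, core.inner (stdRep V g u) (stdRep V g v) = core.inner u v := by
    intro g hg u v
    refine Fintype.sum_equiv (Equiv.mulRight ⟨g, hg⟩) _ _ fun h => ?_
    simp [map_mul]
  let _ : NormedAddCommGroup V := core.toNormedAddCommGroup
  let _ : InnerProductSpace ℂ V := InnerProductSpace.ofCore core.toCore
  let b := stdOrthonormalBasis ℂ V
  refine ⟨b.toBasis, fun g hg i j => ?_⟩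
  simp only [OrthonormalBasis.coe_toBasis, OrthonormalBasis.coe_toBasis_repr_apply,
    OrthonormalBasis.repr_apply_apply]
  have h1 : inner ℂ (b j) (stdRep V g⁻¹ (b i)) = inner ℂ (stdRep V g (b j)) (b i) := by
    rw [← show core.inner _ _ = inner ℂ (b j) (stdRep V g⁻¹ (b i)) from rfl,
      ← hinv g hg, ← Module.End.mul_apply, ← map_mul, mul_inv_cancel, map_one]
    rfl
  rw [h1, ← inner_conj_symm]
  rfl

end Unitary

/-! ### Invariants, the ideal of coinvariants, and harmonic polynomials -/

section Coinvariants

variable {V : Type*} [AddCommGroup V] [Module ℂ V]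

/-- The space of invariant polynomials. -/
def invs (K : Subgroup (LinearMap.GeneralLinearGroup ℂ V)) :
    Submodule ℂ (SymmetricAlgebra ℂ (Module.Dual ℂ V)) where
  carrier := {f | ∀ k ∈ K, polyRep V k f = f}
  zero_mem' := fun k _ => map_zero _
  add_mem' := fun ha hb k hk => by rw [map_add, ha k hk, hb k hk]
  smul_mem' := fun c a ha k hk => by rw [map_smul, ha k hk]

/-- The ideal generated by the homogeneous invariants of positive degree. -/
def coinvIdeal (K : Subgroup (LinearMap.GeneralLinearGroup ℂ V)) :
    Ideal (SymmetricAlgebra ℂ (Module.Dual ℂ V)) :=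
  Ideal.span {f | f ∈ invs K ∧ ∃ n, f ∈ homog (Module.Dual ℂ V) (n + 1)}

variable {K : Subgroup (LinearMap.GeneralLinearGroup ℂ V)}

theorem polyRep_mul (g : LinearMap.GeneralLinearGroup ℂ V)
    (a b : SymmetricAlgebra ℂ (Module.Dual ℂ V)) :
    polyRep V g (a * b) = polyRep V g a * polyRep V g b := symRep_mul _ g a b

theorem polyRep_mul_apply (g h : LinearMap.GeneralLinearGroup ℂ V)
    (a : SymmetricAlgebra ℂ (Module.Dual ℂ V)) :
    polyRep V (g * h) a = polyRep V g (polyRep V h a) := symRep_mul_apply _ g h a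

theorem polyRep_mem_homog (g : LinearMap.GeneralLinearGroup ℂ V) {n : ℕ}
    {a : SymmetricAlgebra ℂ (Module.Dual ℂ V)} (h : a ∈ homog (Module.Dual ℂ V) n) :
    polyRep V g a ∈ homog (Module.Dual ℂ V) n := symRep_mem_homog _ g h

theorem hcomp_polyRep (g : LinearMap.GeneralLinearGroup ℂ V) (n : ℕ)
    (a : SymmetricAlgebra ℂ (Module.Dual ℂ V)) :
    hcomp _ n (polyRep V g a) = polyRep V g (hcomp _ n a) := hcomp_symRep _ n g a

theorem mul_mem_invs {a b : SymmetricAlgebra ℂ (Module.Dual ℂ V)} (ha : a ∈ invs K)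
    (hb : b ∈ invs K) : a * b ∈ invs K := fun k hk => by
  rw [polyRep_mul, ha k hk, hb k hk]

theorem mul_mem_invs_mul {C : Submodule ℂ (SymmetricAlgebra ℂ (Module.Dual ℂ V))}
    {u x : SymmetricAlgebra ℂ (Module.Dual ℂ V)} (hu : u ∈ invs K) (hx : x ∈ invs K * C) :
    u * x ∈ invs K * C := by
  induction hx using Submodule.mul_induction_on' with
  | mem_mul_mem a ha c hc =>
    rw [← mul_assoc]; exact Submodule.mul_mem_mul (mul_mem_invs hu ha) hc
  | add x _ y _ hx hy => rw [mul_add]; exact add_mem hx hy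

theorem algebraMap_mem_invs (c : ℂ) : algebraMap ℂ _ c ∈ invs K :=
  fun k _ => symRep_algebraMap _ k c

theorem hcomp_mem_invs {a : SymmetricAlgebra ℂ (Module.Dual ℂ V)} (ha : a ∈ invs K) (n : ℕ) :
    hcomp _ n a ∈ invs K := fun k hk => by
  rw [← hcomp_polyRep, ha k hk]

/-- The action preserves degrees, so the homogeneous components of an invariant are invariant, and
those of positive degree are generators of the ideal. -/
theorem sub_const_mem_coinvIdeal {f : SymmetricAlgebra ℂ (Module.Dual ℂ V)} (hf : f ∈ invs K) :
    f - algebraMap ℂ _ (SymmetricAlgebra.algebraMapInv f) ∈ coinvIdeal K := by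
  rw [← hcomp_zero]
  refine mem_of_hcomp_mem (p := (coinvIdeal K).restrictScalars ℂ) fun n => ?_
  rw [map_sub, Submodule.restrictScalars_mem]
  cases n with
  | zero => rw [hcomp_of_mem (hcomp_mem 0 f), sub_self]; exact zero_mem _
  | succ n =>
    rw [hcomp_of_mem_ne (hcomp_mem 0 f) (Nat.succ_ne_zero n).symm, sub_zero]
    exact Ideal.subset_span ⟨hcomp_mem_invs hf _, n, hcomp_mem _ f⟩

theorem hcomp_mem_coinvIdeal {x : SymmetricAlgebra ℂ (Module.Dual ℂ V)} (hx : x ∈ coinvIdeal K)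
    (n : ℕ) : hcomp _ n x ∈ coinvIdeal K := by
  induction hx using Submodule.span_induction generalizing n with
  | mem u hu =>
    obtain ⟨-, d, hd⟩ := id hu
    by_cases h : d + 1 = n
    · subst h; rw [hcomp_of_mem hd]; exact Ideal.subset_span hu
    · rw [hcomp_of_mem_ne hd h]; exact zero_mem _
  | zero => rw [map_zero]; exact zero_mem _
  | add x y _ _ hx hy => rw [map_add]; exact add_mem (hx n) (hy n)
  | smul a x _ hx =>
    obtain ⟨s, hs⟩ := exists_sum_hcomp x
    rw [hs, smul_eq_mul, Finset.mul_sum, map_sum]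
    refine sum_mem fun m _ => ?_
    by_cases h : m ≤ n
    · rw [hcomp_mul_of_le _ (hcomp_mem m x) h]; exact Ideal.mul_mem_left _ _ (hx m)
    · rw [hcomp_mul_of_not_le _ (hcomp_mem m x) h]; exact zero_mem _

theorem polyRep_mem_coinvIdeal {x : SymmetricAlgebra ℂ (Module.Dual ℂ V)}
    (hx : x ∈ coinvIdeal K) {k : LinearMap.GeneralLinearGroup ℂ V} (hk : k ∈ K) :
    polyRep V k x ∈ coinvIdeal K := by
  induction hx using Submodule.span_induction with
  | mem u hu => rw [hu.1 k hk]; exact Ideal.subset_span hu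
  | zero => rw [map_zero]; exact zero_mem _
  | add x y _ _ hx hy => rw [map_add]; exact add_mem hx hy
  | smul a x _ hx => rw [smul_eq_mul, polyRep_mul]; exact Ideal.mul_mem_left _ _ hx

end Coinvariants

/-! ### The Fischer form in coordinates, and harmonics as an orthogonal complement -/

section FischerForm

open MvPolynomial

variable {V : Type*} [AddCommGroup V] [Module ℂ V] {σ : Type*} [Fintype σ] [DecidableEq σ]
  (b : Module.Basis σ ℂ V)

/-- Coordinates on polynomial functions. -/
def polyEquiv : SymmetricAlgebra ℂ (Module.Dual ℂ V) ≃ₐ[ℂ] MvPolynomial σ ℂ :=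
  SymmetricAlgebra.equivMvPolynomial b.dualBasis

/-- The Fischer form on polynomial functions. -/
def form (f : SymmetricAlgebra ℂ (Module.Dual ℂ V)) :
    SymmetricAlgebra ℂ (Module.Dual ℂ V) →ₗ[ℂ] ℂ :=
  fischer (polyEquiv b f) ∘ₗ (polyEquiv b).toLinearMap

theorem form_apply (f g : SymmetricAlgebra ℂ (Module.Dual ℂ V)) :
    form b f g = fischer (polyEquiv b f) (polyEquiv b g) := rfl

theorem form_add_left (f f' g : SymmetricAlgebra ℂ (Module.Dual ℂ V)) :
    form b (f + f') g = form b f g + form b f' g := by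
  simp only [form_apply, map_add, fischer_add_left]

theorem form_smul_left (c : ℂ) (f g : SymmetricAlgebra ℂ (Module.Dual ℂ V)) :
    form b (c • f) g = star c * form b f g := by
  simp only [form_apply, map_smul, fischer_smul_left]

theorem form_zero_left (g : SymmetricAlgebra ℂ (Module.Dual ℂ V)) : form b 0 g = 0 := by
  simpa using form_smul_left b 0 0 g

theorem form_sum_left {ι : Type*} (s : Finset ι) (f : ι → SymmetricAlgebra ℂ (Module.Dual ℂ V))
    (g : SymmetricAlgebra ℂ (Module.Dual ℂ V)) :
    form b (∑ i ∈ s, f i) g = ∑ i ∈ s, form b (f i) g := by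
  classical
  induction s using Finset.induction_on with
  | empty => simp [form_zero_left]
  | insert i s hi h => rw [Finset.sum_insert hi, Finset.sum_insert hi, form_add_left, h]

theorem eq_zero_of_form_self {f : SymmetricAlgebra ℂ (Module.Dual ℂ V)} (h : form b f f = 0) :
    f = 0 := (polyEquiv b).map_eq_zero_iff.1 (eq_zero_of_fischer_self h)

theorem polyEquiv_ι_dualBasis (i : σ) :
    polyEquiv b (SymmetricAlgebra.ι ℂ _ (b.dualBasis i)) = X i :=
  SymmetricAlgebra.equivMvPolynomial_ι_apply _ i

theorem polyEquiv_ι (φ : Module.Dual ℂ V) :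
    polyEquiv b (SymmetricAlgebra.ι ℂ _ φ) = ∑ i, C (φ (b i)) * X i := by
  conv_lhs => rw [← b.sum_dual_apply_smul_coord φ]
  simp only [map_sum, map_smul, ← b.coe_dualBasis, polyEquiv_ι_dualBasis, smul_eq_C_mul]

/-- Both sides obey the Leibniz rule, so it suffices to compare them on linear forms. -/
theorem polyEquiv_dirDeriv (i : σ) (f : SymmetricAlgebra ℂ (Module.Dual ℂ V)) :
    polyEquiv b (dirDeriv (b i) f) = pderiv i (polyEquiv b f) := by
  induction f using SymmetricAlgebra.induction with
  | algebraMap c => simp [dirDeriv_algebraMap, MvPolynomial.algebraMap_eq]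
  | ι φ =>
    rw [dirDeriv_ι, polyEquiv_ι, AlgEquiv.commutes, map_sum, Finset.sum_eq_single i]
    · simp [MvPolynomial.algebraMap_eq]
    · intro j _ hj; rw [pderiv_C_mul, pderiv_X_of_ne hj, mul_zero]
    · simp
  | add a c ha hc => simp only [map_add, ha, hc]
  | mul a c ha hc => simp only [dirDeriv_mul, map_add, map_mul, ha, hc, Derivation.leibniz,
      smul_eq_mul]

theorem polyEquiv_mem {n : ℕ} {f : SymmetricAlgebra ℂ (Module.Dual ℂ V)}
    (h : f ∈ homog (Module.Dual ℂ V) n) : (polyEquiv b f).IsHomogeneous n := by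
  unfold homog at h
  induction h using Submodule.pow_induction_on_left' with
  | algebraMap r =>
    rw [AlgEquiv.commutes, MvPolynomial.algebraMap_eq]; exact isHomogeneous_C _ _
  | add x y i hx hy ihx ihy => rw [map_add]; exact ihx.add ihy
  | mem_mul m hm i x hx ih =>
    obtain ⟨φ, rfl⟩ := hm
    rw [map_mul, Nat.succ_eq_one_add, polyEquiv_ι]
    refine IsHomogeneous.mul (IsHomogeneous.sum _ _ _ fun j _ => ?_) ih
    simpa using (isHomogeneous_C σ (φ (b j))).mul (isHomogeneous_X ℂ j)

theorem form_homog_ne {m n : ℕ} {f g : SymmetricAlgebra ℂ (Module.Dual ℂ V)}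
    (hf : f ∈ homog (Module.Dual ℂ V) m) (hg : g ∈ homog (Module.Dual ℂ V) n) (h : m ≠ n) :
    form b f g = 0 := by
  rw [form_apply, fischer_eq_sum _ _ subset_rfl]
  refine Finset.sum_eq_zero fun a ha => ?_
  have h1 : a.degree = n := by
    by_contra h1
    exact mem_support_iff.1 ha ((polyEquiv_mem b hg).coeff_eq_zero h1)
  rw [(polyEquiv_mem b hf).coeff_eq_zero (by rw [h1]; exact h.symm)]
  simp

theorem form_hcomp_right {n : ℕ} (f : SymmetricAlgebra ℂ (Module.Dual ℂ V))
    {g : SymmetricAlgebra ℂ (Module.Dual ℂ V)} (hg : g ∈ homog (Module.Dual ℂ V) n) :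
    form b f g = form b (hcomp _ n f) g := by
  obtain ⟨s, hs⟩ := exists_sum_hcomp f
  have key : ∀ m, form b (hcomp _ m f) g = form b (hcomp _ n (hcomp _ m f)) g := by
    intro m
    by_cases h : m = n
    · subst h; rw [hcomp_of_mem (hcomp_mem m f)]
    · rw [hcomp_of_mem_ne (hcomp_mem m f) h, form_homog_ne b (hcomp_mem m f) hg h,
        form_zero_left]
  conv_lhs => rw [hs]
  conv_rhs => rw [hs, map_sum]
  rw [form_sum_left, form_sum_left]
  exact Finset.sum_congr rfl fun m _ => key m

theorem form_hcomp_left {n : ℕ} {f : SymmetricAlgebra ℂ (Module.Dual ℂ V)}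
    (hf : f ∈ homog (Module.Dual ℂ V) n) (g : SymmetricAlgebra ℂ (Module.Dual ℂ V)) :
    form b f g = form b f (hcomp _ n g) := by
  obtain ⟨s, hs⟩ := exists_sum_hcomp g
  have key : ∀ m, form b f (hcomp _ m g) = form b f (hcomp _ n (hcomp _ m g)) := by
    intro m
    by_cases h : m = n
    · subst h; rw [hcomp_of_mem (hcomp_mem m g)]
    · rw [hcomp_of_mem_ne (hcomp_mem m g) h, form_homog_ne b hf (hcomp_mem m g) (Ne.symm h),
        map_zero]
  conv_lhs => rw [hs]
  conv_rhs => rw [hs, map_sum]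
  rw [map_sum, map_sum]
  exact Finset.sum_congr rfl fun m _ => key m

/-- The semilinear isomorphism `S(V) ≃ S(V*)` defined by the Hermitian form with orthonormal
basis `b`. -/
def conjSym : SymmetricAlgebra ℂ V ≃+* SymmetricAlgebra ℂ (Module.Dual ℂ V) :=
  ((SymmetricAlgebra.equivMvPolynomial b).toRingEquiv.trans
    (MvPolynomial.mapEquiv σ (starRingAut (R := ℂ)))).trans (polyEquiv b).symm.toRingEquiv

theorem polyEquiv_conjSym (p : SymmetricAlgebra ℂ V) : polyEquiv b (conjSym b p) =
    MvPolynomial.map (starRingEnd ℂ) (SymmetricAlgebra.equivMvPolynomial b p) :=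
  (polyEquiv b).apply_symm_apply _

theorem conjSym_algebraMap (c : ℂ) :
    conjSym b (algebraMap ℂ _ c) = algebraMap ℂ _ (star c) := by
  apply (polyEquiv b).injective
  rw [polyEquiv_conjSym, AlgEquiv.commutes, AlgEquiv.commutes, MvPolynomial.algebraMap_eq, map_C]
  rfl

theorem conjSym_smul (c : ℂ) (p : SymmetricAlgebra ℂ V) :
    conjSym b (c • p) = star c • conjSym b p := by
  rw [Algebra.smul_def, map_mul, conjSym_algebraMap, ← Algebra.smul_def]

theorem conjSym_ι_basis (i : σ) :
    conjSym b (SymmetricAlgebra.ι ℂ V (b i)) = SymmetricAlgebra.ι ℂ _ (b.dualBasis i) := by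
  apply (polyEquiv b).injective
  rw [polyEquiv_conjSym, polyEquiv_ι_dualBasis, SymmetricAlgebra.equivMvPolynomial_ι_apply, map_X]

theorem conjSym_ι (v : V) : conjSym b (SymmetricAlgebra.ι ℂ V v) =
    ∑ i, star (b.repr v i) • SymmetricAlgebra.ι ℂ _ (b.dualBasis i) := by
  conv_lhs => rw [← b.sum_repr v]
  simp only [map_sum, map_smul, conjSym_smul, conjSym_ι_basis]

theorem form_ι_mul (i : σ) (f g : SymmetricAlgebra ℂ (Module.Dual ℂ V)) :
    form b (SymmetricAlgebra.ι ℂ _ (b.dualBasis i) * f) g = form b f (dirDeriv (b i) g) := by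
  rw [form_apply, map_mul, polyEquiv_ι_dualBasis, fischer_X_mul, ← polyEquiv_dirDeriv]; rfl

/-- Multiplication is adjoint to the action by differential operators. -/
theorem form_conjSym_mul (p : SymmetricAlgebra ℂ V) :
    ∀ f g : SymmetricAlgebra ℂ (Module.Dual ℂ V),
      form b (conjSym b p * f) g = form b f (diffOp V p g) := by
  induction p using SymmetricAlgebra.induction with
  | algebraMap c =>
    intro f g
    rw [conjSym_algebraMap, ← Algebra.smul_def, form_smul_left, star_star, AlgHom.commutes,
      Module.algebraMap_end_apply, map_smul, smul_eq_mul]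
  | ι v =>
    intro f g
    rw [conjSym_ι, diffOp_ι, Finset.sum_mul, form_sum_left]
    have : dirDeriv v g = ∑ i, b.repr v i • dirDeriv (b i) g := by
      change dirDerivₗ V v g = ∑ i, b.repr v i • dirDerivₗ V (b i) g
      conv_lhs => rw [← b.sum_repr v]
      simp only [map_sum, map_smul, LinearMap.sum_apply, LinearMap.smul_apply]
    rw [this, map_sum]
    refine Finset.sum_congr rfl fun i _ => ?_
    rw [smul_mul_assoc, form_smul_left, star_star, form_ι_mul, map_smul, smul_eq_mul]
  | add p q hp hq =>
    intro f g
    simp only [map_add, add_mul, form_add_left, hp, hq, LinearMap.add_apply]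
  | mul p q hp hq =>
    intro f g
    rw [map_mul, mul_comm (conjSym b p), mul_assoc, hq, hp, ← Module.End.mul_apply,
      ← map_mul]

theorem algebraMapInv_conjSym (p : SymmetricAlgebra ℂ V) :
    SymmetricAlgebra.algebraMapInv (conjSym b p) = star (SymmetricAlgebra.algebraMapInv p) := by
  induction p using SymmetricAlgebra.induction with
  | algebraMap c => rw [conjSym_algebraMap, algebraMapInv_algebraMap, algebraMapInv_algebraMap]
  | ι v => simp [conjSym_ι, SymmetricAlgebra.algebraMapInv_ι]
  | add p q hp hq => simp only [map_add, star_add, hp, hq]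
  | mul p q hp hq => simp only [map_mul, star_mul', hp, hq]

variable {b} {K : Subgroup (LinearMap.GeneralLinearGroup ℂ V)}

/-- By multiplicativity only degree one matters, and there the identity is exactly unitarity of the
matrix of `k`. This is what lets invariant symbols correspond to invariant polynomials. -/
theorem conjSym_equivariant (hb : IsUnitaryBasis K b) {k : LinearMap.GeneralLinearGroup ℂ V}
    (hk : k ∈ K) (p : SymmetricAlgebra ℂ V) :
    conjSym b (symbolRep V k p) = polyRep V k (conjSym b p) := by
  unfold symbolRep polyRep
  induction p using SymmetricAlgebra.induction with
  | algebraMap c => simp only [symRep_algebraMap, conjSym_algebraMap]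
  | ι v =>
    conv_lhs => rw [← b.sum_repr v]
    conv_rhs => rw [← b.sum_repr v]
    simp only [map_sum, map_smul, conjSym_smul, symRep_ι, conjSym_ι_basis]
    refine Finset.sum_congr rfl fun j _ => ?_
    rw [conjSym_ι]
    congr 1
    rw [← b.sum_dual_apply_smul_coord ((stdRep V).dual k (b.dualBasis j)), map_sum]
    refine Finset.sum_congr rfl fun i _ => ?_
    rw [map_smul, ← b.coe_dualBasis]
    congr 1
    rw [← hb k hk i j]
    simp [Representation.dual_apply, Module.Dual.transpose_apply]
  | add p q hp hq => simp only [map_add, hp, hq]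
  | mul p q hp hq => simp only [map_mul, symRep_mul, hp, hq]

/-- The harmonic polynomials are the orthogonal complement of the ideal of coinvariants. -/
theorem mem_harmonic_iff (hb : IsUnitaryBasis K b) {f : SymmetricAlgebra ℂ (Module.Dual ℂ V)} :
    f ∈ harmonic K ↔ ∀ x ∈ coinvIdeal K, form b x f = 0 := by
  constructor
  · intro hf x hx
    -- Allowing an arbitrary multiple `a` lets the span induction absorb the ideal coefficients.
    suffices h : ∀ a, form b (x * a) f = 0 by simpa using h 1
    induction hx using Submodule.span_induction with
    | mem u hu =>
      intro a
      obtain ⟨p, rfl⟩ := (conjSym b).surjective u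
      obtain ⟨hinv, n, hn⟩ := hu
      have : diffOp V p f = 0 := by
        refine hf p (fun k hk => (conjSym b).injective ?_) ?_
        · rw [conjSym_equivariant hb hk, hinv k hk]
        · apply star_injective
          rw [← algebraMapInv_conjSym b, algebraMapInv_of_mem_homog_succ hn, star_zero]
      rw [form_conjSym_mul, this, map_zero]
    | zero => intro a; rw [zero_mul]; exact form_zero_left b f
    | add x y _ _ hx hy => intro a; rw [add_mul, form_add_left, hx, hy, add_zero]
    | smul c x _ ih => intro a; rw [smul_eq_mul, mul_comm c, mul_assoc]; exact ih _
  · intro h p hp h0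
    -- By adjointness the squared norm of `p(∂) f` is the pairing of `conjSym b p * p(∂) f` with
    -- `f`, and `conjSym b p` is an invariant without constant term, hence in the ideal.
    apply eq_zero_of_form_self b
    rw [← form_conjSym_mul]
    refine h _ (Ideal.mul_mem_right _ _ ?_)
    have h1 : conjSym b p ∈ invs K := fun k hk => by
      rw [← conjSym_equivariant hb hk, hp k hk]
    have := sub_const_mem_coinvIdeal h1
    rwa [algebraMapInv_conjSym, h0, star_zero, map_zero, sub_zero] at this

end FischerForm

/-! ### Polynomials as the product of invariants and harmonics -/

section HarmonicDecomposition

variable {V : Type*} [AddCommGroup V] [Module ℂ V] [FiniteDimensional ℂ V]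
  {K : Subgroup (LinearMap.GeneralLinearGroup ℂ V)} [Finite K]

theorem eq_zero_of_mem_harmonic_of_mem_coinvIdeal {f : SymmetricAlgebra ℂ (Module.Dual ℂ V)}
    (hf : f ∈ harmonic K) (hf' : f ∈ coinvIdeal K) : f = 0 := by
  obtain ⟨b, hb⟩ := exists_isUnitaryBasis K
  exact eq_zero_of_form_self b ((mem_harmonic_iff hb).1 hf f hf')

/-- The ideal is graded and distinct degrees are orthogonal, so its orthogonal complement is graded
too. -/
theorem hcomp_mem_harmonic {f : SymmetricAlgebra ℂ (Module.Dual ℂ V)}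
    (hf : f ∈ harmonic K) (n : ℕ) : hcomp _ n f ∈ harmonic K := by
  obtain ⟨b, hb⟩ := exists_isUnitaryBasis K
  rw [mem_harmonic_iff hb] at hf ⊢
  intro x hx
  rw [form_hcomp_right b x (hcomp_mem n f), ← form_hcomp_left b (hcomp_mem n x)]
  exact hf _ (hcomp_mem_coinvIdeal hx n)

theorem hcomp_mem_harmonicDeg {f : SymmetricAlgebra ℂ (Module.Dual ℂ V)}
    (hf : f ∈ harmonic K) (n : ℕ) : hcomp _ n f ∈ harmonicDeg K n :=
  ⟨hcomp_mem_harmonic hf n, hcomp_mem n f⟩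

/-- It is enough to project onto the degree `n` part of the ideal, which is finite-dimensional: the
other degrees of the ideal are orthogonal to `f - a` automatically. -/
theorem exists_sub_mem_harmonic {n : ℕ} {f : SymmetricAlgebra ℂ (Module.Dual ℂ V)}
    (hf : f ∈ homog (Module.Dual ℂ V) n) :
    ∃ a ∈ coinvIdeal K, f - a ∈ harmonic K := by
  obtain ⟨b, hb⟩ := exists_isUnitaryBasis K
  let I := (coinvIdeal K).restrictScalars ℂ ⊓ homog (Module.Dual ℂ V) n
  have : FiniteDimensional ℂ I := Submodule.finiteDimensional_of_le inf_le_right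
  obtain ⟨a', ⟨a, ha, rfl⟩, h⟩ := exists_fischer_orthogonal
    (I.map (polyEquiv b).toLinearMap) (polyEquiv b f)
  refine ⟨a, ha.1, (mem_harmonic_iff hb).2 fun x hx => ?_⟩
  rw [form_hcomp_right b x (sub_mem hf ha.2), form_apply, map_sub]
  exact h _ ⟨hcomp _ n x, ⟨hcomp_mem_coinvIdeal hx n, hcomp_mem n x⟩, rfl⟩

/-- Modulo the ideal, `f` is harmonic. The part in the ideal is a combination of invariants of
positive degree, so its coefficients may be taken of smaller degree, where induction applies. -/
theorem homog_le_invs_mul_harmonic (n : ℕ) :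
    homog (Module.Dual ℂ V) n ≤ invs K * harmonic K := by
  induction n using Nat.strong_induction_on with
  | _ n ih =>
  intro f hf
  have key : ∀ x ∈ coinvIdeal K, hcomp _ n x ∈ invs K * harmonic K := by
    intro x hx
    suffices h : ∀ a, hcomp _ n (a * x) ∈ invs K * harmonic K by simpa using h 1
    induction hx using Submodule.span_induction with
    | mem u hu =>
      intro a
      obtain ⟨hinv, d, hd⟩ := hu
      by_cases h : d + 1 ≤ n
      · rw [hcomp_mul_of_le _ hd h]
        have h1 := ih (n - (d + 1)) (by omega) (hcomp_mem (n - (d + 1)) a)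
        rw [mul_comm _ u]
        exact mul_mem_invs_mul hinv h1
      · rw [hcomp_mul_of_not_le _ hd h]; exact zero_mem _
    | zero => intro a; rw [mul_zero, map_zero]; exact zero_mem _
    | add x y _ _ hx hy => intro a; rw [mul_add, map_add]; exact add_mem (hx a) (hy a)
    | smul c x _ ih' => intro a; rw [smul_eq_mul, ← mul_assoc]; exact ih' _
  obtain ⟨a, ha, h⟩ := exists_sub_mem_harmonic (K := K) hf
  have h1 : f = hcomp _ n a + 1 * hcomp _ n (f - a) := by
    rw [one_mul, ← map_add, add_sub_cancel, hcomp_of_mem hf]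
  rw [h1]
  refine add_mem (key a ha) (Submodule.mul_mem_mul ?_ (hcomp_mem_harmonic h n))
  simpa using algebraMap_mem_invs (K := K) 1

theorem invs_mul_harmonic : invs K * harmonic K = ⊤ := by
  refine eq_top_iff.2 fun f _ => mem_of_hcomp_mem fun n => ?_
  exact homog_le_invs_mul_harmonic n (hcomp_mem n f)

end HarmonicDecomposition

/-! ### Chevalley's theorem -/

section Chevalley

variable {V : Type*} [AddCommGroup V] [Module ℂ V]

/-- A linear map fixing pointwise the kernel of a linear form `α ≠ 0` changes every polynomial by
a multiple of `α`. -/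
theorem exists_dvd_polyRep_sub (s : LinearMap.GeneralLinearGroup ℂ V) {α : Module.Dual ℂ V}
    (h : ∀ φ : Module.Dual ℂ V, ∃ c : ℂ, (stdRep V).dual s φ - φ = c • α)
    (f : SymmetricAlgebra ℂ (Module.Dual ℂ V)) :
    ∃ g, polyRep V s f - f = SymmetricAlgebra.ι ℂ _ α * g := by
  unfold polyRep
  induction f using SymmetricAlgebra.induction with
  | algebraMap c => exact ⟨0, by rw [symRep_algebraMap, sub_self, mul_zero]⟩
  | ι φ =>
    obtain ⟨c, hc⟩ := h φ
    refine ⟨algebraMap ℂ _ c, ?_⟩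
    rw [symRep_ι, ← map_sub, hc, map_smul, Algebra.smul_def, mul_comm]
  | add a b ha hb =>
    obtain ⟨x, hx⟩ := ha
    obtain ⟨y, hy⟩ := hb
    exact ⟨x + y, by rw [map_add, mul_add, ← hx, ← hy]; ring⟩
  | mul a b ha hb =>
    obtain ⟨x, hx⟩ := ha
    obtain ⟨y, hy⟩ := hb
    refine ⟨symRep (stdRep V).dual s a * y + x * b, ?_⟩
    rw [symRep_mul]
    linear_combination symRep (stdRep V).dual s a * hy + b * hx

/-- Directional derivatives recover the values of `α`. -/
theorem ι_dual_ne_zero {α : Module.Dual ℂ V} (h : α ≠ 0) :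
    SymmetricAlgebra.ι ℂ (Module.Dual ℂ V) α ≠ 0 := by
  intro h0
  refine h (LinearMap.ext fun v => ?_)
  have := dirDeriv_ι v α
  rw [h0, map_zero, eq_comm, SymmetricAlgebra.algebraMap_eq_zero_iff] at this
  exact this

/-- The symmetric algebra is a domain, so no component of `g` in another degree can be killed by
`α`. -/
theorem mem_homog_of_mul_mem {α : Module.Dual ℂ V} (hα : α ≠ 0) {n : ℕ}
    {g : SymmetricAlgebra ℂ (Module.Dual ℂ V)}
    (h : SymmetricAlgebra.ι ℂ _ α * g ∈ homog (Module.Dual ℂ V) (n + 1)) :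
    g ∈ homog (Module.Dual ℂ V) n := by
  have key : ∀ m, hcomp _ (m + 1) (g * SymmetricAlgebra.ι ℂ _ α) =
      hcomp _ m g * SymmetricAlgebra.ι ℂ _ α := fun m =>
    hcomp_mul_of_le g (ι_mem_homog α) (by omega)
  refine mem_of_hcomp_mem fun m => ?_
  by_cases hm : m = n
  · subst hm; exact hcomp_mem _ _
  · have := key m
    rw [mul_comm g, hcomp_of_mem_ne h (by omega)] at this
    rw [(mul_eq_zero.1 this.symm).resolve_right (ι_dual_ne_zero hα)]
    exact zero_mem _

/-- Take `α` with kernel the fixed hyperplane. The form `s φ - φ` vanishes there, hence is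
proportional to `α`. -/
theorem IsReflection.exists_form {s : LinearMap.GeneralLinearGroup ℂ V} [FiniteDimensional ℂ V]
    (hs : IsReflection s) : ∃ α : Module.Dual ℂ V, α ≠ 0 ∧
      ∀ φ : Module.Dual ℂ V, ∃ c : ℂ, (stdRep V).dual s φ - φ = c • α := by
  obtain ⟨-, P, hP, hfix⟩ := hs
  have hlt : P < ⊤ := by
    refine lt_top_iff_ne_top.2 fun h => ?_
    rw [h, finrank_top] at hP; omega
  obtain ⟨α, hα, hPα⟩ := Submodule.exists_le_ker_of_lt_top P hlt
  have hker : LinearMap.ker α = P := by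
    refine (Submodule.eq_of_le_of_finrank_le hPα ?_).symm
    have := Module.Dual.finrank_ker_add_one_of_ne_zero hα
    omega
  refine ⟨α, hα, fun φ => ?_⟩
  have hle : LinearMap.ker α ≤ LinearMap.ker ((stdRep V).dual s φ - φ) := by
    intro x hx
    rw [hker] at hx
    have h1 : stdRep V s⁻¹ x = x := by
      conv_lhs => rw [← hfix x hx]
      rw [← Module.End.mul_apply, ← map_mul, inv_mul_cancel, map_one]; rfl
    rw [LinearMap.mem_ker, LinearMap.sub_apply, sub_eq_zero]
    change φ (stdRep V s⁻¹ x) = φ x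
    rw [h1]
  have hspan := mem_span_of_iInf_ker_le_ker (L := fun _ : Unit => α) (by simpa using hle)
  rw [Set.range_const, Submodule.mem_span_singleton] at hspan
  obtain ⟨c, hc⟩ := hspan
  exact ⟨c, hc.symm⟩

variable {K : Subgroup (LinearMap.GeneralLinearGroup ℂ V)}

theorem sum_polyRep_mem_invs [Fintype K] (f : SymmetricAlgebra ℂ (Module.Dual ℂ V)) :
    ∑ k : K, polyRep V k f ∈ invs K := by
  intro h hh
  rw [map_sum]
  refine Fintype.sum_equiv (Equiv.mulLeft ⟨h, hh⟩) _ _ fun k => ?_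
  simp

/-- If `s g - g` lies in the ideal of coinvariants for every reflection `s`, then it does for
every group element. -/
theorem polyRep_sub_mem_coinvIdeal (hK : IsReflectionGroup K)
    {g : SymmetricAlgebra ℂ (Module.Dual ℂ V)}
    (h : ∀ s ∈ K, IsReflection s → polyRep V s g - g ∈ coinvIdeal K)
    {k : LinearMap.GeneralLinearGroup ℂ V} (hk : k ∈ K) : polyRep V k g - g ∈ coinvIdeal K := by
  have hK' := hK.generated
  suffices hs : ∀ k ∈ Subgroup.closure {g | g ∈ K ∧ IsReflection g},
      k ∈ K ∧ polyRep V k g - g ∈ coinvIdeal K from (hs k (hK'.symm ▸ hk)).2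
  intro k hk
  induction hk using Subgroup.closure_induction with
  | mem s hs => exact ⟨hs.1, h s hs.1 hs.2⟩
  | one => exact ⟨one_mem _, by rw [map_one, Module.End.one_apply, sub_self]; exact zero_mem _⟩
  | mul x y _ _ hx hy =>
    refine ⟨mul_mem hx.1 hy.1, ?_⟩
    have := add_mem (polyRep_mem_coinvIdeal hy.2 hx.1) hx.2
    rwa [map_sub, sub_add_sub_cancel, ← polyRep_mul_apply] at this
  | inv x _ hx =>
    refine ⟨inv_mem hx.1, ?_⟩
    have := neg_mem (polyRep_mem_coinvIdeal hx.2 (inv_mem hx.1))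
    rwa [map_sub, ← polyRep_mul_apply, inv_mul_cancel, map_one, Module.End.one_apply,
      neg_sub] at this

/-- Chevalley's lemma on relations with invariant coefficients. -/
theorem chevalley_relation [FiniteDimensional ℂ V] (hK : IsReflectionGroup K) {ι : Type*}
    [DecidableEq ι] {s : Finset ι} {f : ι → SymmetricAlgebra ℂ (Module.Dual ℂ V)}
    (hf : ∀ i, f i ∈ invs K) {i₀ : ι} (hi₀ : i₀ ∈ s) (n : ℕ) :
    ∀ g : ι → SymmetricAlgebra ℂ (Module.Dual ℂ V), g i₀ ∈ homog _ n →
      ∑ i ∈ s, f i * g i = 0 → g i₀ ∈ coinvIdeal K ∨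
        ∃ a : ι → SymmetricAlgebra ℂ (Module.Dual ℂ V), (∀ i, a i ∈ invs K) ∧
          f i₀ = ∑ i ∈ s.erase i₀, a i * f i := by
  have := hK.finite
  have := Fintype.ofFinite K
  have hcard : ((Fintype.card K : ℕ) : ℂ) ≠ 0 := Nat.cast_ne_zero.2 Fintype.card_ne_zero
  have hsum : ∀ k ∈ K, ∀ g : ι → SymmetricAlgebra ℂ (Module.Dual ℂ V),
      ∑ i ∈ s, f i * g i = 0 → ∑ i ∈ s, f i * polyRep V k (g i) = 0 := by
    intro k hk g hg
    have := congrArg (polyRep V k) hg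
    simpa only [map_sum, polyRep_mul, hf _ k hk, map_zero] using this
  induction n with
  | zero =>
    intro g hg h
    obtain ⟨c, hc⟩ := homog_zero_eq hg
    by_cases hc0 : c = 0
    · left; rw [← hc, hc0, map_zero]; exact zero_mem _
    right
    -- Averaging makes all coefficients invariant and multiplies the constant `c` at `i₀` by the
    -- order of `K`; the averaged relation can then be solved for `f i₀`.
    have havg : ∑ i ∈ s, f i * ∑ k : K, polyRep V k (g i) = 0 := by
      simp only [Finset.mul_sum]
      rw [Finset.sum_comm]
      exact Finset.sum_eq_zero fun k _ => hsum k k.2 g h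
    have h0 : ∑ k : K, polyRep V k (g i₀) = algebraMap ℂ _ (Fintype.card K * c) := by
      have : ∀ k : K, polyRep V k (g i₀) = g i₀ := fun k => by
        rw [← hc]; exact algebraMap_mem_invs (K := K) c k k.2
      rw [Finset.sum_congr rfl fun k _ => this k, Finset.sum_const, Finset.card_univ, ← hc,
        nsmul_eq_mul, map_mul, map_natCast]
    rw [← Finset.add_sum_erase _ _ hi₀, h0] at havg
    refine ⟨fun i => algebraMap ℂ _ (-(Fintype.card K * c)⁻¹) * ∑ k : K, polyRep V k (g i),
      fun i => mul_mem_invs (algebraMap_mem_invs _) (sum_polyRep_mem_invs _), ?_⟩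
    have hinv : algebraMap ℂ (SymmetricAlgebra ℂ (Module.Dual ℂ V)) (Fintype.card K * c)⁻¹ *
        algebraMap ℂ _ (Fintype.card K * c) = 1 := by
      rw [← map_mul, inv_mul_cancel₀ (mul_ne_zero hcard hc0), map_one]
    have e : ∀ i, algebraMap ℂ _ (-(Fintype.card K * c)⁻¹) * (∑ k : K, polyRep V k (g i)) * f i =
        -algebraMap ℂ _ (Fintype.card K * c)⁻¹ * (f i * ∑ k : K, polyRep V k (g i)) := fun i => by
      rw [map_neg]; ring
    simp only [e, ← Finset.mul_sum]
    linear_combination algebraMap ℂ _ (Fintype.card K * c)⁻¹ * havg - f i₀ * hinv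
  | succ n ih =>
    intro g hg h
    by_cases hne : ∃ a : ι → SymmetricAlgebra ℂ (Module.Dual ℂ V), (∀ i, a i ∈ invs K) ∧
        f i₀ = ∑ i ∈ s.erase i₀, a i * f i
    · exact Or.inr hne
    left
    -- Subtracting the relation from its image under `t` and dividing by the linear form `α` of the
    -- reflection gives a relation with the same `f` in one degree less.
    have hrefl : ∀ t ∈ K, IsReflection t → polyRep V t (g i₀) - g i₀ ∈ coinvIdeal K := by
      intro t ht hrt
      obtain ⟨α, hα, hα'⟩ := hrt.exists_form
      choose u hu using fun i => exists_dvd_polyRep_sub t hα' (g i)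
      have hu0 : u i₀ ∈ homog _ n := by
        refine mem_homog_of_mul_mem hα ?_
        rw [← hu]
        exact sub_mem (polyRep_mem_homog t hg) hg
      have hrel : ∑ i ∈ s, f i * u i = 0 := by
        have h1 : SymmetricAlgebra.ι ℂ _ α * ∑ i ∈ s, f i * u i = 0 := by
          have h2 : SymmetricAlgebra.ι ℂ _ α * ∑ i ∈ s, f i * u i =
              ∑ i ∈ s, f i * polyRep V t (g i) - ∑ i ∈ s, f i * g i := by
            rw [Finset.mul_sum, ← Finset.sum_sub_distrib]
            exact Finset.sum_congr rfl fun i _ => by linear_combination - f i * hu i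
          rw [h2, hsum t ht g h, h, sub_zero]
        exact (mul_eq_zero.1 h1).resolve_left (ι_dual_ne_zero hα)
      rw [hu]
      exact Ideal.mul_mem_left _ _ ((ih u hu0 hrel).resolve_right hne)
    -- The sum of the translates of `g i₀` is an invariant of positive degree, hence in the ideal,
    -- and it is congruent to the order of `K` times `g i₀`.
    have hall : ∑ k : K, (polyRep V k (g i₀) - g i₀) ∈ coinvIdeal K :=
      sum_mem fun k _ => polyRep_sub_mem_coinvIdeal hK hrefl k.2
    have havg : ∑ k : K, polyRep V k (g i₀) ∈ coinvIdeal K :=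
      Ideal.subset_span ⟨sum_polyRep_mem_invs _, n, sum_mem fun k _ => polyRep_mem_homog _ hg⟩
    have := sub_mem havg hall
    rw [Finset.sum_sub_distrib, sub_sub_cancel, Finset.sum_const, Finset.card_univ,
      nsmul_eq_mul] at this
    have h2 := Ideal.mul_mem_left _ (algebraMap ℂ _ (Fintype.card K : ℂ)⁻¹) this
    rwa [← mul_assoc, ← map_natCast (algebraMap ℂ (SymmetricAlgebra ℂ (Module.Dual ℂ V))),
      ← map_mul, inv_mul_cancel₀ hcard, map_one, one_mul] at h2

/-- Homogeneous polynomials that are linearly independent modulo the ideal of coinvariants are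
linearly independent over the invariants: the case of a homogeneous relation. -/
theorem eq_zero_of_homog_relation [FiniteDimensional ℂ V] (hK : IsReflectionGroup K) {ι : Type*}
    {d e : ι → ℕ} {D : ℕ} (s : Finset ι) (hde : ∀ i ∈ s, e i + d i = D)
    {f : ι → SymmetricAlgebra ℂ (Module.Dual ℂ V)} (hf : ∀ i, f i ∈ invs K)
    (hf' : ∀ i, f i ∈ homog _ (e i)) :
    ∀ c : ι → SymmetricAlgebra ℂ (Module.Dual ℂ V), (∀ i ∈ s, c i ∈ homog _ (d i)) →
      (∀ a : ι → ℂ, ∑ i ∈ s, a i • c i ∈ coinvIdeal K → ∀ i ∈ s, a i = 0) →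
      ∑ i ∈ s, f i * c i = 0 → ∀ i ∈ s, f i = 0 := by
  classical
  induction s using Finset.induction_on with
  | empty => simp
  | insert i₀ t hi₀ ih =>
    intro c hc hind h
    have hi₀' : i₀ ∈ insert i₀ t := Finset.mem_insert_self _ _
    have hne : ∀ i ∈ t, i ≠ i₀ := fun i hi hii => hi₀ (hii ▸ hi)
    rcases chevalley_relation hK hf hi₀' (d i₀) c (hc _ hi₀') h with hI | ⟨a, ha, hfa⟩
    · have := hind (Pi.single i₀ 1) (by
        rw [Finset.sum_insert hi₀, Pi.single_eq_same, one_smul, Finset.sum_eq_zero, add_zero]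
        · exact hI
        · intro i hi; rw [Pi.single_eq_of_ne (hne i hi), zero_smul]) i₀ hi₀'
      simp at this
    rw [Finset.erase_insert hi₀] at hfa
    -- The coefficients `a i` are replaced by their components of degree `e i₀ - e i`, so that
    -- substituting for `f i₀` leaves a homogeneous relation. The case distinction guards the
    -- truncated subtraction.
    let a' : ι → SymmetricAlgebra ℂ (Module.Dual ℂ V) := fun i =>
      if e i ≤ e i₀ then hcomp _ (e i₀ - e i) (a i) else 0
    have ha' : ∀ i, a' i ∈ invs K := by
      intro i
      by_cases hle : e i ≤ e i₀
      · simpa only [a', if_pos hle] using hcomp_mem_invs (ha i) _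
      · simpa only [a', if_neg hle] using zero_mem _
    have hfa' : f i₀ = ∑ i ∈ t, a' i * f i := by
      rw [← hcomp_of_mem (hf' i₀), hfa, map_sum]
      refine Finset.sum_congr rfl fun i _ => ?_
      by_cases hle : e i ≤ e i₀
      · simp only [a', if_pos hle]; exact hcomp_mul_of_le _ (hf' i) hle
      · simp only [a', if_neg hle, zero_mul]; exact hcomp_mul_of_not_le _ (hf' i) hle
    have ht : ∀ i ∈ t, f i = 0 := by
      refine ih (fun i hi => hde i (Finset.mem_insert_of_mem hi)) (fun i => c i + a' i * c i₀)
        ?_ ?_ ?_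
      · intro i hi
        refine add_mem (hc i (Finset.mem_insert_of_mem hi)) ?_
        by_cases hle : e i ≤ e i₀
        · have h1 := hde i (Finset.mem_insert_of_mem hi)
          have h2 := hde i₀ hi₀'
          have h3 : d i = (e i₀ - e i) + d i₀ := by omega
          simp only [a', if_pos hle, h3]
          exact SetLike.mul_mem_graded (hcomp_mem _ _) (hc i₀ hi₀')
        · simp only [a', if_neg hle, zero_mul]; exact zero_mem _
      · intro γ hγ
        -- Modulo the ideal the invariant `a' i` is its constant term, so `c i + a' i * c i₀` is
        -- congruent to `c i + ε i • c i₀`, and independence modulo the ideal is inherited.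
        let ε : ι → ℂ := fun i => SymmetricAlgebra.algebraMapInv (a' i)
        have hε : ∑ i ∈ t, γ i • ((a' i - algebraMap ℂ _ (ε i)) * c i₀) ∈ coinvIdeal K :=
          sum_mem fun i _ => by
            rw [Algebra.smul_def]
            exact Ideal.mul_mem_left _ _
              (Ideal.mul_mem_right _ _ (sub_const_mem_coinvIdeal (ha' i)))
        have h1 := sub_mem hγ hε
        have h2 := hind (Function.update γ i₀ (∑ i ∈ t, γ i * ε i)) (by
          rw [Finset.sum_insert hi₀, Function.update_self]
          convert! h1 using 1
          rw [← Finset.sum_sub_distrib, Finset.sum_smul, ← Finset.sum_add_distrib]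
          refine Finset.sum_congr rfl fun i hi => ?_
          rw [Function.update_of_ne (hne i hi)]
          simp only [Algebra.smul_def, map_mul]
          ring)
        intro i hi
        simpa only [Function.update_of_ne (hne i hi)] using h2 i (Finset.mem_insert_of_mem hi)
      · rw [Finset.sum_insert hi₀, hfa', Finset.sum_mul, ← Finset.sum_add_distrib] at h
        rw [← h]
        exact Finset.sum_congr rfl fun i _ => by ring
    intro i hi
    rcases Finset.mem_insert.1 hi with rfl | hi
    · rw [hfa']; exact Finset.sum_eq_zero fun j hj => by rw [ht j hj, mul_zero]
    · exact ht i hi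

/-- Linearly independent homogeneous harmonic polynomials are linearly independent over the
invariants. -/
theorem eq_zero_of_relation [FiniteDimensional ℂ V] (hK : IsReflectionGroup K) {ι : Type*}
    [Finite ι] {d : ι → ℕ} {c : ι → SymmetricAlgebra ℂ (Module.Dual ℂ V)}
    (hc : ∀ i, c i ∈ harmonicDeg K (d i)) (hind : LinearIndependent ℂ c)
    {f : ι → SymmetricAlgebra ℂ (Module.Dual ℂ V)} (hf : ∀ i, f i ∈ invs K)
    (s : Finset ι) (h : ∑ i ∈ s, f i * c i = 0) : ∀ i ∈ s, f i = 0 := by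
  have := hK.finite
  intro i hi
  refine eq_zero_of_hcomp_eq_zero fun n => ?_
  -- In the degree `D` part of the relation, the coefficient of `c i` is the degree `n` component of
  -- `f i`. Terms with `d j > D` drop out and are filtered away, since `D - d j` is truncated.
  let D := n + d i
  let e : ι → ℕ := fun j => D - d j
  have hei : e i = n := by simp only [e, D]; omega
  rw [← hei]
  refine eq_zero_of_homog_relation hK (d := d) (e := e) (D := D) (s.filter fun j => d j ≤ D)
    (fun j hj => ?_) (fun j => hcomp_mem_invs (hf j) (e j)) (fun j => hcomp_mem _ _) c
    (fun j _ => (hc j).2) (fun a ha => ?_) ?_ i (Finset.mem_filter.2 ⟨hi, ?_⟩)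
  · have := (Finset.mem_filter.1 hj).2
    simp only [e]; omega
  · refine linearIndependent_iff'.1 hind _ a ?_
    exact eq_zero_of_mem_harmonic_of_mem_coinvIdeal
      (sum_mem fun j _ => Submodule.smul_mem _ _ (hc j).1) ha
  · have h1 := congrArg (hcomp _ D) h
    rw [map_zero, map_sum] at h1
    rw [← h1, Finset.sum_filter]
    refine Finset.sum_congr rfl fun j _ => ?_
    by_cases hle : d j ≤ D
    · rw [if_pos hle, hcomp_mul_of_le _ (hc j).2 hle]
    · rw [if_neg hle, hcomp_mul_of_not_le _ (hc j).2 hle]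
  · simp only [D]; omega

end Chevalley

/-! ### The harmonic polynomials form the regular representation -/

section Orbit

variable {V : Type*} [AddCommGroup V] [Module ℂ V]
  {K : Subgroup (LinearMap.GeneralLinearGroup ℂ V)}

variable (V) in
/-- The action on polynomials by multiplicative maps. -/
def polyMonoidHom (g : LinearMap.GeneralLinearGroup ℂ V) :
    SymmetricAlgebra ℂ (Module.Dual ℂ V) →* SymmetricAlgebra ℂ (Module.Dual ℂ V) where
  toFun := polyRep V g
  map_one' := symRep_one _ g
  map_mul' := polyRep_mul g

theorem polyMonoidHom_injective : Function.Injective (polyMonoidHom V) := by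
  intro g h hgh
  have key : ∀ v, stdRep V g⁻¹ v = stdRep V h⁻¹ v := by
    intro v
    rw [← sub_eq_zero, ← Module.forall_dual_apply_eq_zero_iff ℂ]
    intro φ
    have h1 : polyRep V g (SymmetricAlgebra.ι ℂ _ φ) = polyRep V h (SymmetricAlgebra.ι ℂ _ φ) :=
      DFunLike.congr_fun hgh (SymmetricAlgebra.ι ℂ _ φ)
    unfold polyRep at h1
    rw [symRep_ι, symRep_ι, ← sub_eq_zero, ← map_sub] at h1
    have h2 : (stdRep V).dual g φ - (stdRep V).dual h φ = 0 := by
      by_contra hne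
      exact ι_dual_ne_zero hne h1
    rw [map_sub]
    exact LinearMap.congr_fun h2 v
  have : g⁻¹ = h⁻¹ := Units.ext (LinearMap.ext key)
  exact inv_injective this

/-- Dedekind independence of the elements of `K` acting on polynomials. -/
theorem eq_zero_of_sum_mul_polyRep [Fintype K]
    {a : K → SymmetricAlgebra ℂ (Module.Dual ℂ V)}
    (h : ∀ f, ∑ k : K, a k * polyRep V k f = 0) (k : K) : a k = 0 := by
  have hind := (linearIndependent_monoidHom (SymmetricAlgebra ℂ (Module.Dual ℂ V))
    (SymmetricAlgebra ℂ (Module.Dual ℂ V))).comp (fun k : K => polyMonoidHom V k)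
    (polyMonoidHom_injective.comp Subtype.val_injective)
  refine Fintype.linearIndependent_iff.1 hind a (funext fun f => ?_) k
  rw [Finset.sum_apply]
  exact h f

/-- The matrix of values of the polynomials `c` along the group elements. -/
def orbitMatrix {ι : Type*} (K : Subgroup (LinearMap.GeneralLinearGroup ℂ V))
    (c : ι → SymmetricAlgebra ℂ (Module.Dual ℂ V)) :
    Matrix K ι (SymmetricAlgebra ℂ (Module.Dual ℂ V)) :=
  fun k i => polyRep V k (c i)

/-- If `x` is in the kernel, then for every `t` the averages of `x i * t` over `K` are invariant
coefficients of a relation among the `c i`: move each `k` outside, and what remains inside is a row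
of the kernel equation for `k⁻¹`. So the averages vanish for all `t`, and Dedekind independence
gives `x i = 0`. -/
theorem orbitMatrix_mulVec_eq_zero [Fintype K] {ι : Type*} [Fintype ι]
    {c : ι → SymmetricAlgebra ℂ (Module.Dual ℂ V)}
    (hc : ∀ f : ι → SymmetricAlgebra ℂ (Module.Dual ℂ V), (∀ i, f i ∈ invs K) →
      ∑ i, f i * c i = 0 → ∀ i, f i = 0)
    {x : ι → SymmetricAlgebra ℂ (Module.Dual ℂ V)} (hx : (orbitMatrix K c).mulVec x = 0) :
    x = 0 := by
  have hx' : ∀ k : K, ∑ i, polyRep V k (c i) * x i = 0 := fun k => congrFun hx k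
  funext i
  have key : ∀ t, ∑ k : K, polyRep V k (x i) * polyRep V k t = 0 := by
    intro t
    have := hc (fun i => ∑ k : K, polyRep V k (x i * t)) (fun i => sum_polyRep_mem_invs _) (by
      simp only [Finset.sum_mul]
      rw [Finset.sum_comm]
      refine Finset.sum_eq_zero fun k _ => ?_
      have h1 : ∀ i, polyRep V k (x i * t) * c i =
          polyRep V k (t * (polyRep V (k⁻¹ : K) (c i) * x i)) := by
        intro i
        rw [polyRep_mul, polyRep_mul, polyRep_mul, ← polyRep_mul_apply, ← Subgroup.coe_mul,
          mul_inv_cancel, Subgroup.coe_one, map_one, Module.End.one_apply]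
        ring
      simp only [h1, ← map_sum, ← Finset.mul_sum, hx' k⁻¹, mul_zero, map_zero]) i
    simpa only [polyRep_mul] using this
  simpa using eq_zero_of_sum_mul_polyRep key 1

/-- Invariant factors pull out of every translate, so vanishing on the `c i` extends to vanishing on
all polynomials, which Dedekind independence excludes. -/
theorem orbitMatrix_vecMul_eq_zero [Fintype K] {ι : Type*}
    {c : ι → SymmetricAlgebra ℂ (Module.Dual ℂ V)}
    (hc : invs K * Submodule.span ℂ (Set.range c) = ⊤)
    {x : K → SymmetricAlgebra ℂ (Module.Dual ℂ V)} (hx : Matrix.vecMul x (orbitMatrix K c) = 0) :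
    x = 0 := by
  have hx' : ∀ i, ∑ k : K, x k * polyRep V k (c i) = 0 := fun i => congrFun hx i
  funext k
  refine eq_zero_of_sum_mul_polyRep (fun f => ?_) k
  have hf : f ∈ invs K * Submodule.span ℂ (Set.range c) := hc ▸ Submodule.mem_top
  induction hf using Submodule.mul_induction_on' with
  | mem_mul_mem a ha b hb =>
    have h1 : ∀ k : K, x k * polyRep V k (a * b) = a * (x k * polyRep V k b) := fun k => by
      rw [polyRep_mul, ha k k.2]; ring
    simp only [h1, ← Finset.mul_sum]
    clear h1
    induction hb using Submodule.span_induction with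
    | mem b hb => obtain ⟨i, rfl⟩ := hb; rw [hx', mul_zero]
    | zero => simp
    | add b b' _ _ hb hb' => simp only [map_add, mul_add, Finset.sum_add_distrib, hb, hb', add_zero]
    | smul z b _ hb =>
      simp only [map_smul, mul_smul_comm, ← Finset.smul_sum, hb, smul_zero]
  | add a _ b _ ha hb => simp only [map_add, mul_add, Finset.sum_add_distrib, ha, hb, add_zero]

end Orbit

/-! ### Homogeneous bases of the harmonics, finite dimension and the regular character -/

section Regular

variable {V : Type*} [AddCommGroup V] [Module ℂ V] [FiniteDimensional ℂ V]
  {K : Subgroup (LinearMap.GeneralLinearGroup ℂ V)}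

instance harmonicDeg_finite (n : ℕ) : FiniteDimensional ℂ (harmonicDeg K n) :=
  Submodule.finiteDimensional_of_le inf_le_right

variable (K) in
/-- Homogeneous bases of the harmonic polynomials of degree less than `D`. -/
def harmonicFamily (D : ℕ) (p : Σ n : Fin D, Fin (Module.finrank ℂ (harmonicDeg K n))) :
    SymmetricAlgebra ℂ (Module.Dual ℂ V) :=
  (Module.finBasis ℂ (harmonicDeg K p.1) p.2 : SymmetricAlgebra ℂ (Module.Dual ℂ V))

theorem harmonicFamily_mem (D : ℕ) (p : Σ n : Fin D, Fin (Module.finrank ℂ (harmonicDeg K n))) :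
    harmonicFamily K D p ∈ harmonicDeg K p.1 := SetLike.coe_mem _

theorem linearIndependent_harmonicFamily (D : ℕ) : LinearIndependent ℂ (harmonicFamily K D) := by
  rw [Fintype.linearIndependent_iff]
  rintro a h ⟨m, j⟩
  have h1 := congrArg (hcomp _ m) h
  rw [map_zero, map_sum, Fintype.sum_sigma, Finset.sum_eq_single m] at h1
  · have h2 : ∑ j, a ⟨m, j⟩ • Module.finBasis ℂ (harmonicDeg K m) j = 0 := by
      apply Subtype.ext
      rw [Submodule.coe_zero, ← h1]
      push_cast
      refine Finset.sum_congr rfl fun j _ => ?_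
      rw [map_smul, hcomp_of_mem (harmonicFamily_mem D ⟨m, j⟩).2]
      rfl
    exact Fintype.linearIndependent_iff.1 (Module.finBasis ℂ (harmonicDeg K m)).linearIndependent
      (fun j => a ⟨m, j⟩) h2 j
  · intro n _ hn
    refine Finset.sum_eq_zero fun j _ => ?_
    rw [map_smul, hcomp_of_mem_ne (harmonicFamily_mem D ⟨n, j⟩).2
      (fun h => hn (Fin.ext h)), smul_zero]
  · simp

theorem harmonicFamily_relation (hK : IsReflectionGroup K) (D : ℕ)
    (f : (Σ n : Fin D, Fin (Module.finrank ℂ (harmonicDeg K n))) →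
      SymmetricAlgebra ℂ (Module.Dual ℂ V)) (hf : ∀ i, f i ∈ invs K)
    (h : ∑ i, f i * harmonicFamily K D i = 0) : ∀ i, f i = 0 := fun i =>
  eq_zero_of_relation hK (harmonicFamily_mem D) (linearIndependent_harmonicFamily D) hf
    Finset.univ h i (Finset.mem_univ i)

/-- The orbit matrix has independent columns and one row for each element of `K`. -/
theorem card_harmonicFamily_le (hK : IsReflectionGroup K) (D : ℕ) :
    ∑ n : Fin D, Module.finrank ℂ (harmonicDeg K n) ≤ Nat.card K := by
  have := hK.finite
  have := Fintype.ofFinite K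
  have h1 : Function.Injective (orbitMatrix K (harmonicFamily K D)).mulVecLin := by
    rw [← LinearMap.ker_eq_bot, LinearMap.ker_eq_bot']
    exact fun x hx => orbitMatrix_mulVec_eq_zero (harmonicFamily_relation hK D) hx
  have h2 := card_le_of_injective _ _ h1
  rw [Nat.card_eq_fintype_card]
  simpa using h2

/-- The partial sums of dimensions are bounded, so they attain a maximum; no degree from there on
can contribute. -/
theorem exists_harmonicDeg_eq_bot (hK : IsReflectionGroup K) :
    ∃ D, ∀ n, D ≤ n → harmonicDeg K n = ⊥ := by
  let s : ℕ → ℕ := fun D => ∑ n : Fin D, Module.finrank ℂ (harmonicDeg K n)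
  have hfin : (Set.range s).Finite :=
    (Set.finite_Iic (Nat.card K)).subset (by rintro _ ⟨D, rfl⟩; exact card_harmonicFamily_le hK D)
  obtain ⟨_, ⟨D, rfl⟩, hD⟩ := Set.exists_max_image _ id hfin ⟨s 0, 0, rfl⟩
  refine ⟨D, fun n hn => ?_⟩
  have h1 := hD (s (n + 1)) ⟨n + 1, rfl⟩
  simp only [id, s, Fin.sum_univ_eq_sum_range (fun n => Module.finrank ℂ (harmonicDeg K n))] at h1
  rw [Finset.sum_range_succ] at h1
  have h2 := Finset.sum_le_sum_of_subset (f := fun n => Module.finrank ℂ (harmonicDeg K n))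
    (Finset.range_mono hn)
  exact Submodule.finrank_eq_zero.1 (by omega)

theorem eq_sum_hcomp_of_mem_harmonic [Finite K] {D : ℕ} (hD : ∀ n, D ≤ n → harmonicDeg K n = ⊥)
    {f : SymmetricAlgebra ℂ (Module.Dual ℂ V)} (hf : f ∈ harmonic K) :
    f = ∑ n : Fin D, hcomp _ (n : ℕ) f := by
  rw [← sub_eq_zero]
  refine eq_zero_of_hcomp_eq_zero fun m => ?_
  rw [map_sub, map_sum]
  by_cases hm : m < D
  · rw [Finset.sum_eq_single ⟨m, hm⟩, hcomp_of_mem (hcomp_mem m f), sub_self]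
    · intro n _ hn
      exact hcomp_of_mem_ne (hcomp_mem _ f) (fun h => hn (Fin.ext h))
    · simp
  · rw [Finset.sum_eq_zero, sub_zero]
    · exact (Submodule.mem_bot ℂ).1 (hD m (not_lt.1 hm) ▸ hcomp_mem_harmonicDeg hf m)
    · intro n _
      exact hcomp_of_mem_ne (hcomp_mem _ f) (by have := n.2; omega)

theorem span_harmonicFamily [Finite K] {D : ℕ} (hD : ∀ n, D ≤ n → harmonicDeg K n = ⊥) :
    Submodule.span ℂ (Set.range (harmonicFamily K D)) = harmonic K := by
  refine le_antisymm (Submodule.span_le.2 ?_) fun f hf => ?_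
  · rintro _ ⟨p, rfl⟩
    exact (harmonicFamily_mem D p).1
  · rw [eq_sum_hcomp_of_mem_harmonic hD hf]
    refine sum_mem fun n _ => ?_
    have h1 := (Module.finBasis ℂ (harmonicDeg K n)).sum_repr
      ⟨_, hcomp_mem_harmonicDeg hf n⟩
    have h2 := congrArg Subtype.val h1
    simp only at h2
    rw [← h2]
    push_cast
    exact sum_mem fun j _ => Submodule.smul_mem _ _ (Submodule.subset_span ⟨⟨n, j⟩, rfl⟩)

theorem harmonic_finite (hK : IsReflectionGroup K) : FiniteDimensional ℂ (harmonic K) := by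
  have := hK.finite
  obtain ⟨D, hD⟩ := exists_harmonicDeg_eq_bot hK
  rw [← span_harmonicFamily hD]
  exact FiniteDimensional.span_of_finite ℂ (Set.finite_range _)

/-- The character of the space of harmonic polynomials is that of the regular representation. -/
theorem trace_harmonic (hK : IsReflectionGroup K) {g : LinearMap.GeneralLinearGroup ℂ V}
    (hg : g ∈ K) [Decidable (g = 1)] (T : Module.End ℂ (harmonic K))
    (hT : ∀ x, (T x : SymmetricAlgebra ℂ (Module.Dual ℂ V)) = polyRep V g x) :
    LinearMap.trace ℂ _ T = if g = 1 then (Nat.card K : ℂ) else 0 := by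
  classical
  have := hK.finite
  have := Fintype.ofFinite K
  obtain ⟨D, hD⟩ := exists_harmonicDeg_eq_bot hK
  have hspan := span_harmonicFamily hD
  let B : Module.Basis (Σ n : Fin D, Fin (Module.finrank ℂ (harmonicDeg K n))) ℂ (harmonic K) :=
    (Module.Basis.span (linearIndependent_harmonicFamily D)).map (LinearEquiv.ofEq _ _ hspan)
  have hB : ∀ i, (B i : SymmetricAlgebra ℂ (Module.Dual ℂ V)) = harmonicFamily K D i := fun i => by
    simp [B, Module.Basis.span_apply]
  let A := orbitMatrix K (harmonicFamily K D)
  have hcols : ∀ x, A.mulVec x = 0 → x = 0 := fun x hx =>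
    orbitMatrix_mulVec_eq_zero (harmonicFamily_relation hK D) hx
  have hrows : ∀ x, Matrix.vecMul x A = 0 → x = 0 := fun x hx =>
    orbitMatrix_vecMul_eq_zero (by rw [hspan, invs_mul_harmonic]) hx
  -- Trivial left and right kernels force the orbit matrix to be square; after reindexing, its
  -- determinant is nonzero.
  have hcard : Fintype.card K =
      Fintype.card (Σ n : Fin D, Fin (Module.finrank ℂ (harmonicDeg K n))) := by
    refine le_antisymm ?_ ?_
    · refine card_le_of_injective _ A.vecMulLinear ?_
      rw [← LinearMap.ker_eq_bot, LinearMap.ker_eq_bot']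
      exact hrows
    · refine card_le_of_injective _ A.mulVecLin ?_
      rw [← LinearMap.ker_eq_bot, LinearMap.ker_eq_bot']
      exact hcols
  let e := Fintype.equivOfCardEq hcard
  let A' : Matrix K K (SymmetricAlgebra ℂ (Module.Dual ℂ V)) := A.submatrix id e
  have hdet : A'.det ≠ 0 := by
    intro h0
    obtain ⟨x, hx, hx0⟩ := Matrix.exists_mulVec_eq_zero_iff.2 h0
    refine hx ?_
    have h1 : A.mulVec (x ∘ e.symm) = 0 := by
      rw [← hx0]
      funext k
      exact (Fintype.sum_equiv e _ _ fun i => by simp [A']).symm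
    have h2 := hcols _ h1
    funext k
    simpa using congrFun h2 (e k)
  let ρ : Matrix K K (SymmetricAlgebra ℂ (Module.Dual ℂ V)) :=
    ((LinearMap.toMatrix B B T).map (algebraMap ℂ _)).submatrix e e
  let P : Matrix K K (SymmetricAlgebra ℂ (Module.Dual ℂ V)) := fun k l =>
    if k * ⟨g, hg⟩ = l then 1 else 0
  -- Applying `k` to the expansion of `g c_j` in the basis shows that `A'` intertwines the matrix of
  -- `T` with the permutation matrix of right multiplication by `g`.
  have hPA : P * A' = A' * ρ := by
    ext k j
    rw [Matrix.mul_apply, Matrix.mul_apply]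
    simp only [P, ite_mul, one_mul, zero_mul, Finset.sum_ite_eq, Finset.mem_univ, if_true]
    have h1 : T (B (e j)) = ∑ i, LinearMap.toMatrix B B T i (e j) • B i := by
      conv_lhs => rw [← B.sum_repr (T (B (e j)))]
      simp [LinearMap.toMatrix_apply]
    have h2 := congrArg Subtype.val h1
    rw [hT, hB] at h2
    change polyRep V (k * g : LinearMap.GeneralLinearGroup ℂ V) (harmonicFamily K D (e j)) = _
    rw [polyRep_mul_apply, h2]
    push_cast
    rw [map_sum]
    refine (Fintype.sum_equiv e _ _ fun i => ?_).symm
    rw [map_smul, hB, Algebra.smul_def, mul_comm]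
    rfl
  -- The adjugate stands in for the inverse, which exists only over the fraction field; the nonzero
  -- determinant is cancelled in the domain.
  have h1 : A'.det * ρ.trace = A'.det * P.trace := by
    have h2 : (A'.adjugate * (P * A')).trace = (A'.adjugate * (A' * ρ)).trace := by rw [hPA]
    rw [← Matrix.mul_assoc A'.adjugate A' ρ, Matrix.adjugate_mul, Matrix.trace_mul_comm,
      Matrix.mul_assoc, Matrix.mul_adjugate, Matrix.smul_mul, Matrix.mul_smul, Matrix.one_mul,
      Matrix.mul_one, Matrix.trace_smul, Matrix.trace_smul] at h2
    exact h2.symm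
  have h2 := mul_left_cancel₀ hdet h1
  have h3 : ρ.trace = algebraMap ℂ _ (LinearMap.trace ℂ _ T) := by
    rw [LinearMap.trace_eq_matrix_trace ℂ B, Matrix.trace, Matrix.trace, map_sum]
    exact Fintype.sum_equiv e _ _ fun i => rfl
  have h4 : P.trace = algebraMap ℂ _ (if g = 1 then (Nat.card K : ℂ) else 0) := by
    rw [Nat.card_eq_fintype_card]
    have hiff : ∀ k : K, k * ⟨g, hg⟩ = k ↔ g = 1 := fun k => by
      rw [mul_eq_left, Subtype.ext_iff, Subgroup.coe_one]
    have hP : P.trace = ∑ k : K, if k * ⟨g, hg⟩ = k then 1 else 0 := rfl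
    simp only [hP, hiff]
    by_cases h : g = 1 <;> simp [h]
  rw [h3, h4] at h2
  exact (SymmetricAlgebra.algebraMap_inj _ _ _).1 h2

end Regular

/-! ### Graded characters -/

/-- The maps `Φ i` assemble to an isomorphism from the product that carries the block-diagonal
operator with blocks `T i` to `F`. -/
theorem trace_eq_sum_of_bijective {ι : Type*} [Fintype ι] [DecidableEq ι] {A : ι → Type*}
    [∀ i, AddCommGroup (A i)] [∀ i, Module ℂ (A i)] [∀ i, FiniteDimensional ℂ (A i)]
    {E : Type*} [AddCommGroup E] [Module ℂ E] (Φ : ∀ i, A i →ₗ[ℂ] E)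
    (hinj : ∀ x : ∀ i, A i, ∑ i, Φ i (x i) = 0 → x = 0)
    (hsurj : ∀ y, ∃ x : ∀ i, A i, ∑ i, Φ i (x i) = y) (T : ∀ i, Module.End ℂ (A i))
    (F : Module.End ℂ E) (hF : ∀ i x, F (Φ i x) = Φ i (T i x)) :
    LinearMap.trace ℂ E F = ∑ i, LinearMap.trace ℂ (A i) (T i) := by
  have hL : ∀ x : ∀ i, A i, LinearMap.lsum ℂ A ℂ Φ x = ∑ i, Φ i (x i) := fun x => by
    simp [LinearMap.lsum_apply]
  have hΦ : Function.Bijective (LinearMap.lsum ℂ A ℂ Φ) :=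
    ⟨(injective_iff_map_eq_zero _).2 fun x hx => hinj x (hL x ▸ hx),
      fun y => (hsurj y).imp fun x hx => (hL x).trans hx⟩
  let e := LinearEquiv.ofBijective _ hΦ
  let P : Module.End ℂ (∀ i, A i) := ∑ i, LinearMap.single ℂ A i ∘ₗ T i ∘ₗ LinearMap.proj i
  have hP : F = e.conj P := by
    rw [LinearEquiv.conj_apply, LinearEquiv.eq_comp_toLinearMap_symm]
    refine LinearMap.pi_ext fun i x => ?_
    have h1 : P (Pi.single i x) = Pi.single i (T i x) := by
      simp only [P, LinearMap.sum_apply, LinearMap.comp_apply, LinearMap.proj_apply]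
      rw [Finset.sum_eq_single i]
      · simp
      · intro j _ hj; simp [Pi.single_eq_of_ne hj]
      · simp
    have h2 : ∀ i x, e (Pi.single i x) = Φ i x := fun i x => by
      simp only [e, LinearEquiv.ofBijective_apply, LinearMap.lsum_apply, LinearMap.sum_apply,
        LinearMap.comp_apply, LinearMap.proj_apply]
      rw [Finset.sum_eq_single i]
      · simp
      · intro j _ hj; simp [Pi.single_eq_of_ne hj]
      · simp
    simp only [LinearMap.comp_apply, LinearEquiv.coe_coe, h1, h2, hF]
  rw [hP, LinearMap.trace_conj', map_sum]
  refine Finset.sum_congr rfl fun i _ => ?_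
  rw [LinearMap.trace_comp_comm', LinearMap.comp_assoc, LinearMap.proj_comp_single_same,
    LinearMap.comp_id]

theorem trace_eq_sum_of_tensor {ι : Type*} [Fintype ι] {A B : ι → Type*}
    [∀ i, AddCommGroup (A i)] [∀ i, Module ℂ (A i)] [∀ i, FiniteDimensional ℂ (A i)]
    [∀ i, AddCommGroup (B i)] [∀ i, Module ℂ (B i)] [∀ i, FiniteDimensional ℂ (B i)]
    {E : Type*} [AddCommGroup E] [Module ℂ E] (Φ : ∀ i, A i ⊗[ℂ] B i →ₗ[ℂ] E)
    (hinj : ∀ x : ∀ i, A i ⊗[ℂ] B i, ∑ i, Φ i (x i) = 0 → x = 0)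
    (hsurj : ∀ y, ∃ x : ∀ i, A i ⊗[ℂ] B i, ∑ i, Φ i (x i) = y)
    (S : ∀ i, Module.End ℂ (A i)) (T : ∀ i, Module.End ℂ (B i))
    (F : Module.End ℂ E) (hF : ∀ i a b, F (Φ i (a ⊗ₜ b)) = Φ i (S i a ⊗ₜ T i b)) :
    LinearMap.trace ℂ E F = ∑ i, LinearMap.trace ℂ (A i) (S i) * LinearMap.trace ℂ (B i) (T i) := by
  classical
  refine (trace_eq_sum_of_bijective Φ hinj hsurj (fun i => TensorProduct.map (S i) (T i)) F
    fun i x => ?_).trans (Finset.sum_congr rfl fun i _ => LinearMap.trace_tensorProduct' _ _)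
  induction x using TensorProduct.induction_on with
  | zero => simp only [map_zero]
  | add x y hx hy => simp only [map_add, hx, hy]
  | tmul a b => rw [hF, TensorProduct.map_tmul]

section GradedCharacters

variable {V : Type*} [AddCommGroup V] [Module ℂ V]

/-- The homogeneous invariants of degree `n`. -/
def invDeg (K : Subgroup (LinearMap.GeneralLinearGroup ℂ V)) (n : ℕ) :
    Submodule ℂ (SymmetricAlgebra ℂ (Module.Dual ℂ V)) :=
  invs K ⊓ homog (Module.Dual ℂ V) n

theorem invs_stable (K : Subgroup (LinearMap.GeneralLinearGroup ℂ V))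
    {g : LinearMap.GeneralLinearGroup ℂ V} (hg : g ∈ Subgroup.normalizer (K : Set _)) :
    invs K ≤ (invs K).comap (polyRep V g) := by
  intro f hf k hk
  have hk' : g⁻¹ * k * g ∈ K := by
    have := (Subgroup.mem_normalizer_iff.1 (inv_mem hg) k).1 hk
    rwa [inv_inv] at this
  have : k * g = g * (g⁻¹ * k * g) := by group
  rw [← polyRep_mul_apply, this, polyRep_mul_apply, hf _ hk']

variable (G K : Subgroup (LinearMap.GeneralLinearGroup ℂ V))

/-- The `G`-module of homogeneous polynomials of degree `n`. -/
def homogRep (n : ℕ) : Representation ℂ G (homog (Module.Dual ℂ V) n) :=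
  Representation.subrepresentation ((polyRep V).comp G.subtype) (homog (Module.Dual ℂ V) n)
    (fun g => homog_stable _ n g.1)

variable (h : G ≤ Subgroup.normalizer (K : Set _))

/-- The `G`-module of homogeneous `K`-invariants of degree `n`, for `G` normalizing `K`. -/
def invDegRep (n : ℕ) : Representation ℂ G (invDeg K n) :=
  Representation.subrepresentation ((polyRep V).comp G.subtype) (invDeg K n)
    (fun g _ hf => ⟨invs_stable K (h g.2) hf.1, homog_stable _ n g.1 hf.2⟩)

/-- The `G`-module of homogeneous `K`-harmonic polynomials of degree `n`, for `G` normalizing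
`K`. -/
def harmDegRep (n : ℕ) : Representation ℂ G (harmonicDeg K n) :=
  Representation.subrepresentation ((polyRep V).comp G.subtype) (harmonicDeg K n)
    (fun g _ hf => ⟨harmonic_stable K g (h g.2) hf.1, homog_stable _ n g.1 hf.2⟩)

variable {G K}

/-- Multiplication of invariants and harmonic polynomials. -/
def invMulHarm {m n : ℕ} (hmn : m ≤ n) :
    invDeg K (n - m) ⊗[ℂ] harmonicDeg K m →ₗ[ℂ] homog (Module.Dual ℂ V) n :=
  TensorProduct.lift (LinearMap.mk₂ ℂ
    (fun a c => ⟨(a : SymmetricAlgebra ℂ (Module.Dual ℂ V)) * c, by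
      have := SetLike.mul_mem_graded (A := homog (Module.Dual ℂ V)) a.2.2 c.2.2
      rwa [Nat.sub_add_cancel hmn] at this⟩)
    (fun _ _ _ => Subtype.ext (by simp [add_mul])) (fun _ _ _ => Subtype.ext (by simp))
    (fun _ _ _ => Subtype.ext (by simp [mul_add])) (fun _ _ _ => Subtype.ext (by simp)))

variable [FiniteDimensional ℂ V]

instance invDeg_finite (n : ℕ) : FiniteDimensional ℂ (invDeg K n) :=
  Submodule.finiteDimensional_of_le inf_le_right

/-- Expanding each tensor along a basis of its harmonic factor turns the hypothesis into a relation
with invariant coefficients among independent harmonics. -/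
theorem invMulHarm_injective (hK : IsReflectionGroup K) (n : ℕ)
    (x : ∀ m : Fin (n + 1), invDeg K (n - m) ⊗[ℂ] harmonicDeg K m)
    (hx : ∑ m, invMulHarm (Nat.lt_succ_iff.1 m.2) (x m) = 0) : x = 0 := by
  choose r hr using fun m => TensorProduct.eq_repr_basis_right
    (Module.finBasis ℂ (harmonicDeg K (m : Fin (n + 1)))) (x m)
  have hrel : ∑ p : Σ m : Fin (n + 1), Fin (Module.finrank ℂ (harmonicDeg K m)),
      (r p.1 p.2 : SymmetricAlgebra ℂ (Module.Dual ℂ V)) * harmonicFamily K (n + 1) p = 0 := by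
    have h1 := congrArg Subtype.val hx
    rw [Submodule.coe_zero] at h1
    rw [Fintype.sum_sigma, ← h1]
    push_cast
    refine Finset.sum_congr rfl fun m _ => ?_
    rw [← hr m, Finsupp.sum_fintype _ _ (by simp), map_sum]
    push_cast
    exact Finset.sum_congr rfl fun j _ => rfl
  have h0 := harmonicFamily_relation hK (n + 1) (fun p => r p.1 p.2) (fun p => (r p.1 p.2).2.1) hrel
  funext m
  rw [← hr m]
  refine Finset.sum_eq_zero fun j _ => ?_
  have : r m j = 0 := Subtype.ext (h0 ⟨m, j⟩)
  rw [this]; exact TensorProduct.zero_tmul _ _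

theorem invMulHarm_surjective [Finite K] (n : ℕ) (y : homog (Module.Dual ℂ V) n) :
    ∃ x : ∀ m : Fin (n + 1), invDeg K (n - m) ⊗[ℂ] harmonicDeg K m,
      ∑ m, invMulHarm (Nat.lt_succ_iff.1 m.2) (x m) = y := by
  suffices h : ∀ x ∈ invs K * harmonic K, ∃ z : ∀ m : Fin (n + 1),
      invDeg K (n - m) ⊗[ℂ] harmonicDeg K m,
      (∑ m, invMulHarm (Nat.lt_succ_iff.1 m.2) (z m) : homog (Module.Dual ℂ V) n) =
        hcomp _ n x by
    obtain ⟨z, hz⟩ := h y (invs_mul_harmonic (K := K) ▸ Submodule.mem_top)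
    rw [hcomp_of_mem y.2] at hz
    exact ⟨z, Subtype.ext hz⟩
  intro x hx
  induction hx using Submodule.mul_induction_on' with
  | mem_mul_mem a ha c hc =>
    refine ⟨fun m => ⟨hcomp _ (n - m) a, hcomp_mem_invs ha _, hcomp_mem _ a⟩ ⊗ₜ[ℂ]
      ⟨hcomp _ m c, hcomp_mem_harmonicDeg hc m⟩, ?_⟩
    push_cast
    exact (hcomp_mul n a c).symm
  | add x _ y _ hx hy =>
    obtain ⟨z, hz⟩ := hx
    obtain ⟨w, hw⟩ := hy
    refine ⟨z + w, ?_⟩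
    simp only [Pi.add_apply, map_add, Finset.sum_add_distrib]
    rw [← hz, ← hw]; rfl

/-- The graded character of the polynomials is the product of those of the invariants and of the
harmonic polynomials. -/
theorem homogRep_character (hK : IsReflectionGroup K) (n : ℕ) (g : G) :
    (homogRep G n).character g = ∑ p ∈ Finset.HasAntidiagonal.antidiagonal n,
      (invDegRep G K h p.1).character g * (harmDegRep G K h p.2).character g := by
  rw [← Finset.Nat.sum_antidiagonal_swap, Finset.Nat.sum_antidiagonal_eq_sum_range_succ_mk]
  simp only [Prod.fst_swap, Prod.snd_swap]
  rw [Nat.succ_eq_add_one, ← Fin.sum_univ_eq_sum_range (fun m =>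
      (invDegRep G K h (n - m)).character g * (harmDegRep G K h m).character g)]
  have := hK.finite
  exact trace_eq_sum_of_tensor (fun m : Fin (n + 1) => invMulHarm (Nat.lt_succ_iff.1 m.2))
    (invMulHarm_injective hK n) (invMulHarm_surjective n)
    (fun m => invDegRep G K h (n - m) g) (fun m => harmDegRep G K h m g) (homogRep G n g)
    fun m a c => Subtype.ext (polyRep_mul (g : LinearMap.GeneralLinearGroup ℂ V) a c)

theorem harmonicRep_character [Finite K] {D : ℕ} (hD : ∀ n, D ≤ n → harmonicDeg K n = ⊥) (g : G) :
    (harmonicRep G K h).character g = ∑ n ∈ Finset.range D, (harmDegRep G K h n).character g := by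
  rw [← Fin.sum_univ_eq_sum_range (fun n => (harmDegRep G K h n).character g)]
  refine trace_eq_sum_of_bijective (fun n : Fin D => Submodule.inclusion
    (inf_le_left : harmonicDeg K n ≤ harmonic K)) ?_ ?_
    (fun n => harmDegRep G K h n g) _ fun n x => rfl
  · intro x hx
    funext m
    have h1 := congrArg (fun y : harmonic K =>
      hcomp _ (m : ℕ) (y : SymmetricAlgebra ℂ (Module.Dual ℂ V))) hx
    push_cast at h1
    rw [map_sum, Finset.sum_eq_single m] at h1
    · apply Subtype.ext
      rw [map_zero] at h1
      exact (hcomp_of_mem (x m).2.2).symm.trans h1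
    · intro j _ hj
      exact hcomp_of_mem_ne (x j).2.2 (fun h => hj (Fin.ext h))
    · simp
  · intro y
    refine ⟨fun n => ⟨hcomp _ n y, hcomp_mem_harmonicDeg y.2 n⟩, Subtype.ext ?_⟩
    push_cast
    exact (eq_sum_hcomp_of_mem_harmonic hD y.2).symm

end GradedCharacters

/-! ### Characters of invariants -/

section Average

variable {Γ A W : Type*} [Group Γ] [AddCommGroup A] [Module ℂ A] [FiniteDimensional ℂ A]
  [AddCommGroup W] [Module ℂ W]

/-- The character of the invariants of a subgroup is the average of the character over the
cosets of the subgroup. -/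
theorem character_eq_average (σ : Representation ℂ Γ A) (τ : Representation ℂ Γ W)
    (S : Subgroup Γ) [Fintype S] (j : W →ₗ[ℂ] A) (hj : Function.Injective j)
    (hjτ : ∀ g w, j (τ g w) = σ g (j w)) (hjS : ∀ w, ∀ s ∈ S, σ s (j w) = j w)
    (hS : ∀ x, (∀ s ∈ S, σ s x = x) → ∃ w, j w = x) (g : Γ) :
    τ.character g = (Fintype.card S : ℂ)⁻¹ * ∑ s : S, σ.character (g * s) := by
  have hcard : (Fintype.card S : ℂ) ≠ 0 := Nat.cast_ne_zero.2 Fintype.card_ne_zero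
  have : FiniteDimensional ℂ W := Module.Finite.of_injective j hj
  -- The averaging operator projects onto the `S`-invariants. Since `σ g ∘ E` factors through `W`,
  -- cyclicity of the trace identifies its trace with the character of `τ`.
  let E : Module.End ℂ A := (Fintype.card S : ℂ)⁻¹ • ∑ s : S, σ s
  have hE : ∀ x, E x = (Fintype.card S : ℂ)⁻¹ • ∑ s : S, σ s x := fun x => by
    simp [E, LinearMap.sum_apply]
  have hEinv : ∀ x, ∀ s ∈ S, σ s (E x) = E x := by
    intro x s hs
    rw [hE, map_smul, map_sum]
    congr 1
    refine Fintype.sum_equiv (Equiv.mulLeft ⟨s, hs⟩) _ _ fun t => ?_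
    simp [map_mul]
  have hEj : ∀ w, E (j w) = j w := by
    intro w
    rw [hE, Finset.sum_congr rfl fun (s : S) _ => hjS w s s.2, Finset.sum_const, Finset.card_univ,
      ← Nat.cast_smul_eq_nsmul ℂ, smul_smul, inv_mul_cancel₀ hcard, one_smul]
  choose r hr using fun x => hS (E x) (hEinv x)
  let R : A →ₗ[ℂ] W :=
    { toFun := r
      map_add' := fun x y => hj (by rw [map_add, hr, hr, hr, map_add])
      map_smul' := fun c x => hj (by rw [map_smul, hr, hr, map_smul]; rfl) }
  have h1 : R ∘ₗ j = LinearMap.id := LinearMap.ext fun w => hj (by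
    change j (r (j w)) = j w
    rw [hr, hEj])
  have h2 : σ g ∘ₗ E = j ∘ₗ (τ g ∘ₗ R) := LinearMap.ext fun x => by
    change σ g (E x) = j (τ g (r x))
    rw [hjτ, hr]
  have h3 : LinearMap.trace ℂ A (σ g ∘ₗ E) = τ.character g := by
    rw [h2, ← LinearMap.trace_comp_comm', LinearMap.comp_assoc, h1, LinearMap.comp_id]; rfl
  rw [← h3]
  have h4 : σ g ∘ₗ E = (Fintype.card S : ℂ)⁻¹ • ∑ s : S, σ (g * s) := LinearMap.ext fun x => by
    simp [E, LinearMap.sum_apply, map_sum, map_mul]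
  rw [h4, map_smul, map_sum, smul_eq_mul]
  rfl

/-- Translating the summation variable by `s` changes `ψ` only, so `ψ` can be averaged over cosets
for free. This will trade a module for its `S`-invariants inside an inner product of characters. -/
theorem sum_mul_eq_sum_mul_average [Fintype Γ] (S : Subgroup Γ) [Fintype S] {φ ψ : Γ → ℂ}
    (hφ : ∀ g, ∀ s ∈ S, φ (g * s) = φ g) :
    ∑ g, φ g * ψ g = ∑ g, φ g * ((Fintype.card S : ℂ)⁻¹ * ∑ s : S, ψ (g * s)) := by
  have hcard : (Fintype.card S : ℂ) ≠ 0 := Nat.cast_ne_zero.2 Fintype.card_ne_zero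
  have key : ∀ s : S, ∑ g, φ g * ψ (g * s) = ∑ g, φ g * ψ g := fun s =>
    Fintype.sum_equiv (Equiv.mulRight (s : Γ)) _ _ fun g => by simp [hφ g s s.2]
  have h1 : ∀ g, φ g * ((Fintype.card S : ℂ)⁻¹ * ∑ s : S, ψ (g * s)) =
      (Fintype.card S : ℂ)⁻¹ * ∑ s : S, φ g * ψ (g * s) := fun g => by
    rw [← Finset.mul_sum]; ring
  simp only [h1]
  rw [← Finset.mul_sum, Finset.sum_comm, Finset.sum_congr rfl fun s _ => key s, Finset.sum_const, Finset.card_univ,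
    nsmul_eq_mul, ← mul_assoc, inv_mul_cancel₀ hcard, one_mul]

theorem tensorInvariantsRep_character {B : Type*} [AddCommGroup B] [Module ℂ B]
    [FiniteDimensional ℂ B] (α : Representation ℂ Γ A) (β : Representation ℂ Γ B)
    (S : Subgroup Γ) [S.Normal] [Fintype S] (g : Γ) :
    (tensorInvariantsRep α β S).character g =
      (Fintype.card S : ℂ)⁻¹ * ∑ s : S, α.character (g * s) * β.character (g * s) := by
  rw [character_eq_average (α.tprod β) (tensorInvariantsRep α β S) S
    (tensorInvariants α β S).subtype (Submodule.subtype_injective _) (fun g w => rfl)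
    (fun w s hs => w.2 ⟨s, hs⟩) (fun x hx => ⟨⟨x, fun s => hx s s.2⟩, rfl⟩) g,
    Representation.char_tensor]
  rfl

end Average

/-! ### Multiplicities in the harmonic polynomials -/

section Multiplicity

variable {V : Type*} [AddCommGroup V] [Module ℂ V]
  {K : Subgroup (LinearMap.GeneralLinearGroup ℂ V)} {X : Type*} [AddCommGroup X] [Module ℂ X]

/-- The multiplicity of a representation in the harmonic polynomials of degree `n`. -/
def mult (τ : Representation ℂ K X) (n : ℕ) : ℕ :=
  Module.finrank ℂ (Representation.IntertwiningMap τ (harmonicDegRep K n))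

theorem mult_eq_zero (τ : Representation ℂ K X) {n : ℕ} (h : harmonicDeg K n = ⊥) :
    mult τ n = 0 := by
  have h0 : ∀ y : harmonicDeg K n, y = 0 := fun y =>
    Subtype.ext ((Submodule.mem_bot ℂ).1 (h ▸ y.2))
  have : Subsingleton (Representation.IntertwiningMap τ (harmonicDegRep K n)) :=
    ⟨fun f g => Representation.IntertwiningMap.ext (LinearMap.ext fun x =>
      (h0 _).trans (h0 _).symm)⟩
  exact Module.finrank_zero_of_subsingleton

section TensorInvariants

variable {A B : Type*} [AddCommGroup A] [Module ℂ A] [AddCommGroup B] [Module ℂ B]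

/-- The character of `(A ⊗ B)^S`. -/
def tensorChar {Γ : Type*} [Group Γ] (α : Representation ℂ Γ A) (β : Representation ℂ Γ B)
    (S : Subgroup Γ) [S.Normal] (g : Γ) : ℂ :=
  (tensorInvariantsRep α β S).character g

theorem tensorChar_mul {Γ : Type*} [Group Γ] (α : Representation ℂ Γ A)
    (β : Representation ℂ Γ B) (S : Subgroup Γ) [S.Normal] (g : Γ) {s : Γ} (hs : s ∈ S) :
    tensorChar α β S (g * s) = tensorChar α β S g := by
  have h1 : tensorInvariantsRep α β S s = 1 := LinearMap.ext fun x => Subtype.ext (x.2 ⟨s, hs⟩)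
  rw [tensorChar, tensorChar, Representation.character, Representation.character, map_mul, h1,
    mul_one]

variable (α : Representation ℂ K A) (β : Representation ℂ K B) (S : Subgroup K) [S.Normal]

/-- The multiplicity of the dual of `(A ⊗ B)^S` in the harmonic polynomials of degree `n`. -/
def tensorMult (n : ℕ) : ℕ := mult (tensorInvariantsRep α β S).dual n

theorem tensorMult_eq_zero {n : ℕ} (h : harmonicDeg K n = ⊥) : tensorMult α β S n = 0 :=
  mult_eq_zero _ h

end TensorInvariants

variable [FiniteDimensional ℂ X]

theorem finrank_intertwining [Fintype K] {Y : Type*} [AddCommGroup Y] [Module ℂ Y]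
    [FiniteDimensional ℂ Y] (τ : Representation ℂ K X) (υ : Representation ℂ K Y) :
    (Module.finrank ℂ (Representation.IntertwiningMap τ υ) : ℂ) =
      (Nat.card K : ℂ)⁻¹ * ∑ k : K, υ.character k * τ.character k⁻¹ := by
  have : Invertible (Nat.card K : ℂ) := invertibleOfNonzero (Nat.cast_ne_zero.2 Nat.card_pos.ne')
  exact (Representation.card_inv_mul_sum_char_mul_char_eq_finrank τ υ).symm

variable [FiniteDimensional ℂ V]

theorem mult_eq [Fintype K] (τ : Representation ℂ K X) (n : ℕ) : (mult τ n : ℂ) =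
    (Nat.card K : ℂ)⁻¹ * ∑ k : K,
      (harmDegRep K K Subgroup.le_normalizer n).character k * τ.character k⁻¹ :=
  finrank_intertwining τ (harmonicDegRep K n)

/-- The total multiplicity in the harmonic polynomials is the dimension. -/
theorem sum_mult (hK : IsReflectionGroup K) {D : ℕ} (hD : ∀ n, D ≤ n → harmonicDeg K n = ⊥)
    (τ : Representation ℂ K X) : ∑ n ∈ Finset.range D, mult τ n = Module.finrank ℂ X := by
  classical
  have := hK.finite
  have := Fintype.ofFinite K
  have hcard : (Nat.card K : ℂ) ≠ 0 := Nat.cast_ne_zero.2 Nat.card_pos.ne'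
  have hreg : ∀ k : K, (harmonicRep K K Subgroup.le_normalizer).character k =
      if k = 1 then (Nat.card K : ℂ) else 0 := fun k => by
    refine (trace_harmonic hK k.2 _ fun x => rfl).trans ?_
    simp only [OneMemClass.coe_eq_one]
  rw [← Nat.cast_inj (R := ℂ), Nat.cast_sum]
  simp only [mult_eq]
  rw [← Finset.mul_sum, Finset.sum_comm]
  -- Summing over all degrees leaves the regular character, which only sees the identity element.
  simp only [← Finset.sum_mul, ← harmonicRep_character Subgroup.le_normalizer hD, hreg]
  rw [Finset.sum_eq_single 1]
  · rw [if_pos rfl, ← mul_assoc, inv_mul_cancel₀ hcard, one_mul, inv_one,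
      Representation.char_one]
  · intro k _ hk; rw [if_neg hk, zero_mul]
  · simp

/-- In the decomposition into invariants times harmonics, `K` acts trivially on the invariant
factor, which therefore contributes only its dimension. -/
theorem finrank_homog_eq (hK : IsReflectionGroup K) (τ : Representation ℂ K X) (n : ℕ) :
    (Module.finrank ℂ (Representation.IntertwiningMap τ (homogRep K n)) : ℂ) =
      ∑ p ∈ Finset.HasAntidiagonal.antidiagonal n,
        (Module.finrank ℂ (invDeg K p.1) : ℂ) * mult τ p.2 := by
  have := hK.finite
  have := Fintype.ofFinite K
  have htriv : ∀ (i : ℕ) (k : K), (invDegRep K K Subgroup.le_normalizer i).character k =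
      Module.finrank ℂ (invDeg K i) := fun i k => by
    have : invDegRep K K Subgroup.le_normalizer i k = LinearMap.id :=
      LinearMap.ext fun x => Subtype.ext (x.2.1 k k.2)
    rw [Representation.character, this, LinearMap.trace_id]
  rw [finrank_intertwining]
  simp only [homogRep_character Subgroup.le_normalizer hK, htriv, Finset.sum_mul, mult_eq]
  rw [Finset.sum_comm, Finset.mul_sum]
  refine Finset.sum_congr rfl fun p _ => ?_
  simp only [mul_assoc, ← Finset.mul_sum]
  ring

section TensorInvariants

variable {A B : Type*} [AddCommGroup A] [Module ℂ A] [FiniteDimensional ℂ A]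
  [AddCommGroup B] [Module ℂ B] [FiniteDimensional ℂ B]
  (α : Representation ℂ K A) (β : Representation ℂ K B) (S : Subgroup K) [S.Normal]

theorem tensorMult_eq [Fintype K] (n : ℕ) : (tensorMult α β S n : ℂ) =
    (Nat.card K : ℂ)⁻¹ * ∑ k : K,
      (harmDegRep K K Subgroup.le_normalizer n).character k * tensorChar α β S k := by
  have : FiniteDimensional ℂ (tensorInvariants α β S) :=
    FiniteDimensional.finiteDimensional_submodule (tensorInvariants α β S)
  rw [tensorMult, mult_eq]
  simp only [Representation.char_dual, inv_inv, tensorChar]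

theorem sum_tensorMult (hK : IsReflectionGroup K) {D : ℕ}
    (hD : ∀ n, D ≤ n → harmonicDeg K n = ⊥) :
    ((∑ n ∈ Finset.range D, tensorMult α β S n : ℕ) : ℂ) = tensorChar α β S 1 := by
  have : FiniteDimensional ℂ (tensorInvariants α β S) :=
    FiniteDimensional.finiteDimensional_submodule (tensorInvariants α β S)
  simp only [tensorMult]
  rw [sum_mult hK hD, tensorChar, Representation.char_one, Subspace.dual_finrank_eq]

theorem sum_homog_mul_tensorChar [Fintype K] (hK : IsReflectionGroup K) (n : ℕ) :
    (Nat.card K : ℂ)⁻¹ * ∑ k : K, (homogRep K n).character k * tensorChar α β S k =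
      ∑ p ∈ Finset.HasAntidiagonal.antidiagonal n,
        (Module.finrank ℂ (invDeg K p.1) : ℂ) * tensorMult α β S p.2 := by
  have : FiniteDimensional ℂ (tensorInvariants α β S) :=
    FiniteDimensional.finiteDimensional_submodule (tensorInvariants α β S)
  simp only [tensorMult]
  rw [← finrank_homog_eq hK, finrank_intertwining]
  simp only [Representation.char_dual, inv_inv, tensorChar]

end TensorInvariants

end Multiplicity

/-! ### The pieces of the Orlik-Solomon space -/

/-- Both sides sum `h a * x b c` over `a + b + c = n`. -/
theorem sum_antidiagonal_rearrange (h : ℕ → ℂ) (x : ℕ → ℕ → ℂ) (n : ℕ) :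
    ∑ p ∈ Finset.HasAntidiagonal.antidiagonal n,
      ∑ q ∈ Finset.HasAntidiagonal.antidiagonal p.1, h q.1 * x p.2 q.2 =
    ∑ p ∈ Finset.HasAntidiagonal.antidiagonal n,
      ∑ q ∈ Finset.HasAntidiagonal.antidiagonal p.2, h p.1 * x q.1 q.2 := by
  rw [Finset.sum_sigma', Finset.sum_sigma']
  refine Finset.sum_nbij' (fun t => ⟨(t.2.1, t.1.2 + t.2.2), (t.1.2, t.2.2)⟩)
    (fun t => ⟨(t.1.1 + t.2.2, t.2.1), (t.1.1, t.2.2)⟩) ?_ ?_ ?_ ?_ ?_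
  · rintro ⟨⟨a, b⟩, ⟨c, d⟩⟩ ht
    simp only [Finset.mem_sigma, Finset.HasAntidiagonal.mem_antidiagonal] at ht ⊢
    exact ⟨by omega, trivial⟩
  · rintro ⟨⟨a, b⟩, ⟨c, d⟩⟩ ht
    simp only [Finset.mem_sigma, Finset.HasAntidiagonal.mem_antidiagonal] at ht ⊢
    exact ⟨by omega, trivial⟩
  · rintro ⟨⟨a, b⟩, ⟨c, d⟩⟩ ht
    simp only [Finset.mem_sigma, Finset.HasAntidiagonal.mem_antidiagonal] at ht
    simp [ht.2]
  · rintro ⟨⟨a, b⟩, ⟨c, d⟩⟩ ht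
    simp only [Finset.mem_sigma, Finset.HasAntidiagonal.mem_antidiagonal] at ht
    simp [ht.2]
  · rintro ⟨⟨a, b⟩, ⟨c, d⟩⟩ ht
    rfl

section OrlikSolomon

variable {V : Type*} [AddCommGroup V] [Module ℂ V]
  {G N : Subgroup (LinearMap.GeneralLinearGroup ℂ V)}

theorem le_normalizer_of_normal (hNG : N ≤ G) [hn : (N.subgroupOf G).Normal] :
    G ≤ Subgroup.normalizer (N : Set _) :=
  (Subgroup.normal_subgroupOf_iff_le_normalizer hNG).1 hn

variable (hNG : N ≤ G) [hn : (N.subgroupOf G).Normal]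
  {M : Type*} [AddCommGroup M] [Module ℂ M] (ρ : Representation ℂ G M)

/-- The multiplicity in degree `l` of the `G`-harmonic polynomials of the dual of the `G`-module
`((C_N)_d ⊗ M*)^N`. -/
def bimult (d l : ℕ) : ℕ :=
  tensorMult (harmDegRep G N (le_normalizer_of_normal hNG) d) ρ.dual (N.subgroupOf G) l

theorem bimult_eq_zero (d : ℕ) {l : ℕ} (h : harmonicDeg G l = ⊥) : bimult hNG ρ d l = 0 :=
  tensorMult_eq_zero _ _ _ h

variable [FiniteDimensional ℂ V] [FiniteDimensional ℂ M]

/-- The character of `C_N` is the sum of those of its graded pieces, and taking `N`-invariants and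
multiplicities is additive. -/
theorem mult_OSRep (hG : IsReflectionGroup G) (hN : IsReflectionGroup N) {D : ℕ}
    (hD : ∀ n, D ≤ n → harmonicDeg N n = ⊥) (n : ℕ) :
    mult (OSRep hNG ρ) n = ∑ d ∈ Finset.range D, bimult hNG ρ d n := by
  classical
  have := hG.finite
  have := Fintype.ofFinite G
  have := hN.finite
  have := harmonic_finite hN
  have h1 : mult (OSRep hNG ρ) n = tensorMult (harmonicRep G N (le_normalizer_of_normal hNG))
    ρ.dual (N.subgroupOf G) n := rfl
  rw [h1, ← Nat.cast_inj (R := ℂ), Nat.cast_sum]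
  simp only [bimult, tensorMult_eq]
  rw [← Finset.mul_sum, Finset.sum_comm]
  simp only [← Finset.mul_sum]
  congr 1
  refine Finset.sum_congr rfl fun g _ => ?_
  simp only [tensorChar, tensorInvariantsRep_character]
  rw [← Finset.mul_sum, Finset.sum_comm]
  simp only [harmonicRep_character _ hD, Finset.sum_mul]

/-- Since the `G`-harmonics are the regular representation, the sum over `l` is the dimension of
`((C_N)_d ⊗ M*)^N`, which the averaging formula identifies with that of `Hom_N(M, (C_N)_d)`. -/
theorem mult_restrictRep (hG : IsReflectionGroup G) (hN : IsReflectionGroup N) {L : ℕ}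
    (hL : ∀ n, L ≤ n → harmonicDeg G n = ⊥) (d : ℕ) :
    mult (restrictRep hNG ρ) d = ∑ l ∈ Finset.range L, bimult hNG ρ d l := by
  classical
  have := hG.finite
  have := hN.finite
  have := Fintype.ofFinite G
  have := Fintype.ofFinite N
  simp only [bimult]
  rw [← Nat.cast_inj (R := ℂ), sum_tensorMult _ _ _ hG hL, mult_eq, tensorChar,
    tensorInvariantsRep_character, ← Nat.card_eq_fintype_card,
    Nat.card_congr (Subgroup.subgroupOfEquivOfLe hNG).toEquiv]
  congr 1
  refine (Fintype.sum_equiv (Subgroup.subgroupOfEquivOfLe hNG).toEquiv _ _ fun s => ?_).symm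
  rw [one_mul, Representation.char_dual]
  rfl

/-- Decompose polynomials into `N`-invariants times `N`-harmonics and average over cosets of `N`
twice. The character of the invariants is constant on cosets, so `C_N ⊗ M*` may be replaced by its
`N`-invariants; these have a character constant on cosets, so the invariant polynomials may be
replaced by all polynomials. -/
theorem finrank_homog_eq_sum [Fintype G] (hN : IsReflectionGroup N) (n : ℕ) :
    (Module.finrank ℂ (Representation.IntertwiningMap ρ (homogRep G n)) : ℂ) =
      ∑ p ∈ Finset.HasAntidiagonal.antidiagonal n, (Nat.card G : ℂ)⁻¹ *
        ∑ g : G, (homogRep G p.1).character g * tensorChar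
          (harmDegRep G N (le_normalizer_of_normal hNG) p.2) ρ.dual (N.subgroupOf G) g := by
  classical
  have hn' := le_normalizer_of_normal hNG
  have hB : ∀ (i : ℕ) (g : G), (invDegRep G N hn' i).character g =
      (Fintype.card (N.subgroupOf G) : ℂ)⁻¹ *
        ∑ s : N.subgroupOf G, (homogRep G i).character (g * s) := fun i g =>
    character_eq_average (homogRep G i) (invDegRep G N hn' i) (N.subgroupOf G)
      (Submodule.inclusion (inf_le_right : invDeg N i ≤ homog _ i))
      (Submodule.inclusion_injective _) (fun g w => rfl)
      (fun w s hs => Subtype.ext (w.2.1 s hs))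
      (fun x hx => ⟨⟨x, fun k hk => congrArg Subtype.val (hx ⟨k, hNG hk⟩ hk), x.2⟩, rfl⟩) g
  have hBs : ∀ (i : ℕ) (g : G), ∀ s ∈ N.subgroupOf G,
      (invDegRep G N hn' i).character (g * s) = (invDegRep G N hn' i).character g := by
    intro i g s hs
    have h1 : invDegRep G N hn' i s = 1 := LinearMap.ext fun x => Subtype.ext (x.2.1 s hs)
    rw [Representation.character, Representation.character, map_mul, h1, mul_one]
  simp only [finrank_intertwining, homogRep_character hn' hN n, Finset.sum_mul]
  rw [Finset.sum_comm, Finset.mul_sum]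
  refine Finset.sum_congr rfl fun p _ => ?_
  congr 1
  have h1 : ∀ g : G, (Fintype.card (N.subgroupOf G) : ℂ)⁻¹ * ∑ s : N.subgroupOf G,
      (harmDegRep G N hn' p.2).character (g * s) * ρ.character (g * s)⁻¹ =
      tensorChar (harmDegRep G N hn' p.2) ρ.dual (N.subgroupOf G) g := fun g => by
    rw [tensorChar, tensorInvariantsRep_character]
    simp only [Representation.char_dual]
  have h2 := sum_mul_eq_sum_mul_average (N.subgroupOf G)
    (fun g s hs => tensorChar_mul (harmDegRep G N hn' p.2) ρ.dual (N.subgroupOf G) g hs)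
    (ψ := (homogRep G p.1).character)
  simp only [← hB] at h2
  simp only [mul_assoc]
  rw [sum_mul_eq_sum_mul_average (N.subgroupOf G) (hBs p.1)]
  simp only [h1]
  simp only [mul_comm] at h2 ⊢
  exact h2.symm

/-- The fake degree of `M` is assembled from those of the graded pieces of the Orlik-Solomon
space. -/
theorem mult_eq_sum (hG : IsReflectionGroup G) (hN : IsReflectionGroup N) (n : ℕ) :
    mult ρ n = ∑ p ∈ Finset.HasAntidiagonal.antidiagonal n, bimult hNG ρ p.1 p.2 := by
  have := hG.finite
  have := Fintype.ofFinite G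
  let H : PowerSeries ℂ := PowerSeries.mk fun i => (Module.finrank ℂ (invDeg G i) : ℂ)
  let F : PowerSeries ℂ := PowerSeries.mk fun i => (mult ρ i : ℂ)
  let Y : PowerSeries ℂ := PowerSeries.mk fun i =>
    ∑ p ∈ Finset.HasAntidiagonal.antidiagonal i, (bimult hNG ρ p.1 p.2 : ℂ)
  -- The constant `1` is an invariant of degree zero, so the Hilbert series of the invariants can be
  -- cancelled in the domain of power series.
  have hH : H ≠ 0 := by
    intro h0
    have h1 := congrArg (PowerSeries.coeff 0) h0
    simp only [H, PowerSeries.coeff_mk, map_zero, Nat.cast_eq_zero] at h1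
    have h2 := Submodule.finrank_eq_zero.1 h1
    have h3 : (1 : SymmetricAlgebra ℂ (Module.Dual ℂ V)) ∈ invDeg G 0 := by
      rw [← map_one (algebraMap ℂ _)]
      exact ⟨algebraMap_mem_invs 1, algebraMap_mem_homog 1⟩
    rw [h2, Submodule.mem_bot] at h3
    exact one_ne_zero h3
  -- Both sides are the series of dimensions of `Hom_G(M, S_m)`: the left one from `S = S^G ⊗ C_G`
  -- directly, the right one by first splitting off the `N`-harmonics.
  have key : H * F = H * Y := by
    ext m
    rw [PowerSeries.coeff_mul, PowerSeries.coeff_mul]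
    simp only [H, F, Y, PowerSeries.coeff_mk]
    rw [← finrank_homog_eq hG, finrank_homog_eq_sum hNG ρ hN]
    simp only [sum_homog_mul_tensorChar _ _ _ hG, Finset.mul_sum]
    exact sum_antidiagonal_rearrange (fun i => (Module.finrank ℂ (invDeg G i) : ℂ))
      (fun j l => (bimult hNG ρ j l : ℂ)) m
  have h1 := congrArg (PowerSeries.coeff n) (mul_left_cancel₀ hH key)
  simp only [F, Y, PowerSeries.coeff_mk] at h1
  exact_mod_cast h1

end OrlikSolomon

/-! ### Exponents -/

/-- The indexing `e` is kept separate from the values `E`, so that a single `e` can serve several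
families of exponents at once. -/
theorem isExponents_of_mult {V : Type*} [AddCommGroup V] [Module ℂ V]
    {K : Subgroup (LinearMap.GeneralLinearGroup ℂ V)} {M : Type*} [AddCommGroup M] [Module ℂ M]
    (τ : Representation ℂ K M) {ι I : Type*} [Fintype ι] [Fintype I] (c : I → ℕ) (E : I → ℕ)
    (e : ι ≃ Σ p : I, Fin (c p)) (h : ∀ n, mult τ n = ∑ p, if n = E p then c p else 0) :
    IsExponents K τ fun i => E (e i).1 := by
  ext n
  rw [map_sum]
  simp only [PowerSeries.coeff_X_pow]
  rw [Equiv.sum_comp e fun p : Σ p : I, Fin (c p) => if n = E p.1 then 1 else 0,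
    Fintype.sum_sigma]
  refine (PowerSeries.coeff_mk _ _).trans ((h n).trans (Finset.sum_congr rfl fun p _ => ?_))
  by_cases hn : n = E p <;> simp [hn]

end ReflGroup

end

/-! ### The common indexing of the three families of exponents -/

theorem mainTheorem6 {V : Type*} [AddCommGroup V] [Module ℂ V] [FiniteDimensional ℂ V]
    (G N : Subgroup (LinearMap.GeneralLinearGroup ℂ V))
    (hG : ReflGroup.IsReflectionGroup G) (hN : ReflGroup.IsReflectionGroup N)
    (hNG : N ≤ G) [(N.subgroupOf G).Normal]
    {M : Type*} [AddCommGroup M] [Module ℂ M] [FiniteDimensional ℂ M]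
    (ρ : Representation ℂ G M) :
    ∃ eN eU eG : Fin (Module.finrank ℂ M) → ℕ,
      ReflGroup.IsExponents N (ReflGroup.restrictRep hNG ρ) eN ∧
      ReflGroup.IsExponents G (ReflGroup.OSRep hNG ρ) eU ∧
      ReflGroup.IsExponents G ρ eG ∧
      ∀ i, eN i + eU i = eG i := by
  obtain ⟨D, hD⟩ := ReflGroup.exists_harmonicDeg_eq_bot hN
  obtain ⟨L, hL⟩ := ReflGroup.exists_harmonicDeg_eq_bot hG
  have h1 := ReflGroup.mult_OSRep hNG ρ hG hN hD
  have h2 := ReflGroup.mult_restrictRep hNG ρ hG hN hL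
  have h3 := ReflGroup.mult_eq_sum hNG ρ hG hN
  have h4 := ReflGroup.sum_mult hN hD (ReflGroup.restrictRep hNG ρ)
  have hxL : ∀ j l, L ≤ l → ReflGroup.bimult hNG ρ j l = 0 := fun j l hl =>
    ReflGroup.bimult_eq_zero hNG ρ j (hL l hl)
  -- For `l < L` the entry is a summand of a sum of natural numbers equal to the multiplicity of `M`
  -- in a zero component of the `N`-harmonics.
  have hxD : ∀ j l, D ≤ j → ReflGroup.bimult hNG ρ j l = 0 := fun j l hj => by
    rcases le_or_gt L l with hl | hl
    · exact hxL j l hl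
    · have h0 := h2 j
      rw [ReflGroup.mult_eq_zero _ (hD j hj), eq_comm, Finset.sum_eq_zero_iff] at h0
      exact h0 l (Finset.mem_range.2 hl)
  -- From here on only the three sums of the array and its support in a `D × L` box matter.
  generalize ReflGroup.bimult hNG ρ = x at h1 h2 h3 hxL hxD
  let c : Fin D × Fin L → ℕ := fun p => x p.1 p.2
  -- The entries of the array add up to the total multiplicity of `M` in the `N`-harmonics, which is
  -- `dim M`.
  have hc : Module.finrank ℂ M = Fintype.card (Σ p, Fin (c p)) := by
    simp only [Fintype.card_sigma, Fintype.card_fin, c]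
    rw [← h4, Fintype.sum_prod_type, ← Fin.sum_univ_eq_sum_range]
    refine Finset.sum_congr rfl fun j _ => ?_
    rw [h2, ← Fin.sum_univ_eq_sum_range]
  let e : Fin (Module.finrank ℂ M) ≃ Σ p, Fin (c p) :=
    (finCongr hc).trans (Fintype.equivFin _).symm
  refine ⟨fun i => (e i).1.1, fun i => (e i).1.2, fun i => (e i).1.1 + (e i).1.2,
    ReflGroup.isExponents_of_mult _ c (fun p => p.1) e fun n => ?_,
    ReflGroup.isExponents_of_mult _ c (fun p => p.2) e fun n => ?_,
    ReflGroup.isExponents_of_mult _ c (fun p => p.1 + p.2) e fun n => ?_, fun i => rfl⟩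
  · rw [Fintype.sum_prod_type, h2, ← Fin.sum_univ_eq_sum_range]
    rcases lt_or_ge n D with hn | hn
    · rw [Finset.sum_eq_single (⟨n, hn⟩ : Fin D)]
      · simp [c]
      · intro j _ hj
        refine Finset.sum_eq_zero fun l _ => if_neg fun h => hj (Fin.ext h.symm)
      · simp
    · rw [Finset.sum_eq_zero fun (l : Fin L) _ => hxD n l hn]
      exact (Finset.sum_eq_zero fun j _ => Finset.sum_eq_zero fun l _ =>
        if_neg (j.2.trans_le hn).ne').symm
  · rw [Fintype.sum_prod_type_right, h1, ← Fin.sum_univ_eq_sum_range]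
    rcases lt_or_ge n L with hn | hn
    · rw [Finset.sum_eq_single (⟨n, hn⟩ : Fin L)]
      · simp [c]
      · intro j _ hj
        refine Finset.sum_eq_zero fun l _ => if_neg fun h => hj (Fin.ext h.symm)
      · simp
    · rw [Finset.sum_eq_zero fun (l : Fin D) _ => hxL l n hn]
      exact (Finset.sum_eq_zero fun j _ => Finset.sum_eq_zero fun l _ =>
        if_neg (j.2.trans_le hn).ne').symm
  -- The antidiagonal may leave the `D × L` box, but the array vanishes there.
  · rw [h3, ← Finset.sum_filter]
    symm
    refine Finset.sum_of_injOn (fun p : Fin D × Fin L => ((p.1 : ℕ), (p.2 : ℕ))) ?_ ?_ ?_ ?_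
    · intro p _ q _ h
      simp only [Prod.mk.injEq] at h
      exact Prod.ext (Fin.ext h.1) (Fin.ext h.2)
    · intro p hp
      simp only [Finset.coe_filter, Set.mem_ofPred_eq] at hp
      simp only [Finset.mem_coe, Finset.HasAntidiagonal.mem_antidiagonal, hp.2]
    · rintro ⟨j, l⟩ hp hn
      rcases le_or_gt D j with hj | hj
      · exact hxD j l hj
      rcases le_or_gt L l with hl | hl
      · exact hxL j l hl
      refine absurd ⟨(⟨j, hj⟩, ⟨l, hl⟩), ?_, rfl⟩ hn
      simp only [Finset.HasAntidiagonal.mem_antidiagonal] at hp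
      simp [hp]
    · intro p _; rfl
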